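/- Let $f,c_1,\dots,c_m:\mathbb R^n\to\mathbb R$ and consider the problem of minimizing $f(x)$ subject to $c_i(x)\le 0$, $i=1,\dots,m$. Fix $\beta>0$, $\rho>0$, $\delta\in(0,1)$, $\sigma\in(0,\tfrac12)$ and a continuous function $\theta_1:(0,\infty)\to(0,\infty)$ with $\theta_1(t)\to0$ as $t\to0$. For $(x,u)\in\mathbb R^n\times\mathbb R^m$ put $$y_i=\tfrac12\Big[\sqrt{(c_i(x)+\rho u_i)^2+4\rho\beta}-(c_i(x)+\rho u_i)\Big],\qquad \lambda_i=\tfrac12\Big[\sqrt{(c_i(x)+\rho u_i)^2+4\rho\beta}+(c_i(x)+\rho u_i)\Big],$$ $r=c(x)+y\in\mathbb R^m$, and let $R$ be the $(n+m)\times m$ matrix whose $i$-th column is $\big(\tfrac{\lambda_i}{y_i+\lambda_i}\nabla c_i(x),\,-\rho\tfrac{y_i}{y_i+\lambda_i}e_i\big)$. For $d=(d_x,d_u)\in\mathbb R^{n+m}$ and $H\in\mathbb R^{n\times n}$ put $$\ell(d)=\rho\nabla f(x)^Td_x+\sum_{i}\tfrac{\rho\beta}{y_i+\lambda_i}\big(\nabla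 c_i(x)^Td_x+\rho d_{u,i}\big),\qquad d^TQd=d_x^THd_x+\sum_i\tfrac{\rho\beta}{(y_i+\lambda_i)^2}\big(\nabla c_i(x)^Td_x+\rho d_{u,i}\big)^2,$$ $\pi_\xi(d)=\xi\,\ell(d)+\|r+R^Td\|-\|r\|$ and $\Phi_\xi(x,u)=\xi\rho f(x)-\xi\rho\beta\sum_i\ln y_i+\|r\|$; here $\|\cdot\|$ is the Euclidean norm. The two-parameter system is $$\rho\nabla f(x)+\sum_i\lambda_i\nabla c_i(x)=0,\qquad c_i(x)+y_i=0\quad(i=1,\dots,m),\tag{S}$$ and $\phi(x,u)\in\mathbb R^{n+m}$ denotes the vector with blocks $\rho\nabla f(x)+\sum_i\lambda_i\nabla c_i(x)$ and $\rho(c(x)+y)$. A subscript $k$ means evaluation at $(x_k,u_k)$, with $H=H_k$ in $Q_k$. Inner iteration. Start from any $(x_0,u_0)$ with $\xi_0=1$. For $k=0,1,2,\dots$, given $H_k$ and $d_k^c$: (a) $d_k=(d_{xk},d_{uk})$ minimizes $\ell_k(d)+\tfrac12d^TQ_kd$ subject to $R_k^Td=R_k^Td_k^c$; (b) if $\xi=\xi_k$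 satisfies $$\pi_{\xi}(d_k)+(1-\delta)\big(\|r_k\|-\|r_k+R_k^Td_k\|\big)\le-\tfrac12\,\xi\, d_k^TQ_kd_k,\tag{P}$$ then $\xi_{k+1}=\xi_k$; otherwise $\xi_{k+1}$ is some number in $(0,\tfrac12\xi_k]$ such that $\xi=\xi_{k+1}$ satisfies (P); (c) $\alpha_k$ is the largest element of $\{1,\delta,\delta^2,\dots\}$ with $\Phi_{\xi_{k+1}}\big((x_k,u_k)+\alpha_kd_k\big)-\Phi_{\xi_{k+1}}(x_k,u_k)\le\sigma\alpha_k\pi_{\xi_{k+1}}(d_k)$; (d) $x_{k+1}=x_k+\alpha_kd_{xk}$ and $\hat u_{k+1}=u_k+\alpha_kd_{uk}$; and $u_{k+1,i}=\hat u_{k+1,i}$ if $c_i(x_{k+1})\ge0$, $u_{k+1,i}=\min\{\hat u_{k+1,i},-\beta/c_i(x_{k+1})\}$ otherwise. The inner algorithm stops at the end of iteration $k$ if $\|\phi(x_{k+1},u_{k+1})\|_\infty\le\rho\,\theta_1(\beta)$ or $\xi_{k+1}\le0.1\min(\sqrt\rho,1)$. Assumptions. $f$ and all $c_i$ are twice continuously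 differentiable; $\{x_k\}$ lies in an open bounded set; $\{H_k\}$ is bounded and, for some $\gamma>0$, $v^TH_kv\ge\rho\gamma\|v\|^2$ for all $k$ and $v\in\mathbb R^n$; there are $\eta_1,\eta_2>0$ such that for all $k$, $\|d_k^c\|\le\eta_1\|R_kr_k\|$ and, if $r_k\ne0$, $\|r_k\|-\|r_k+R_k^Td_k^c\|\ge\eta_2\|R_kr_k\|^2/\|r_k\|$. Theorem. Let infinite sequences be generated by (a)-(d), with the stopping tests disregarded, and let the assumptions hold. Then one of the following two statements is true: (1) there is $\hat\eta>0$ with $\|R_kr_k\|\ge\hat\eta\|r_k\|$ for all $k\ge0$, $\xi_k$ is equal to a positive constant for all sufficiently large $k$, and every limit point of $\{(x_k,u_k)\}$ solves (S); (2) $\xi_k\to0$, and there is an infinite set $\mathcal K$ of indices with $r_k\neq0$ for $k\in\mathcal K$ and $\lim_{k\in\mathcal K,\,k\to\infty}\|R_kr_k\|/\|r_k\|=0$; moreover $r_k\ge0$ for all $k\ge1$, and also for $k=0$ if for every $i$ the starting point satisfies $c_i(x_0)\ge0$ or $u_{0,i}\le-\beta/c_i(x_0)$. In either case there is an index $k$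 at which one of the two stopping tests holds; so the inner algorithm terminates after finitely many iterations. -/

import Mathlib

open Filter Topology

/-- `ℝⁿ` with the Euclidean norm. -/
abbrev Vec (n : ℕ) := EuclideanSpace ℝ (Fin n)

/-- `ℝⁿ⁺ᵐ`, written as pairs `(d_x, d_u)`, with the Euclidean norm. -/
abbrev PairVec (n m : ℕ) := WithLp 2 (Vec n × Vec m)

/-- The data of the nonlinear program: minimize `f x` subject to `c i x ≤ 0` for all `i`. -/
structure NLP (n m : ℕ) where
  f : Vec n → ℝ
  c : Fin m → Vec n → ℝ

namespace NLP

noncomputable section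

variable {n m : ℕ} (P : NLP n m) (β ρ : ℝ)

/-- `y_i(x,u;β,ρ)`. -/
def y (x : Vec n) (u : Vec m) (i : Fin m) : ℝ :=
  (1 / 2) * (√((P.c i x + ρ * u i) ^ 2 + 4 * ρ * β) - (P.c i x + ρ * u i))

/-- `λ_i(x,u;β,ρ)`. -/
def lam (x : Vec n) (u : Vec m) (i : Fin m) : ℝ :=
  (1 / 2) * (√((P.c i x + ρ * u i) ^ 2 + 4 * ρ * β) + (P.c i x + ρ * u i))

/-- The residual `r = c(x) + y(x,u;β,ρ)`. -/
def r (x : Vec n) (u : Vec m) : Vec m :=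
  WithLp.toLp 2 fun i => P.c i x + P.y β ρ x u i

/-- `ρ ∇f(x) + ∑ᵢ λ_i(x,u;β,ρ) ∇c_i(x)`. -/
def lagGrad (x : Vec n) (u : Vec m) : Vec n :=
  ρ • gradient P.f x + ∑ i, P.lam β ρ x u i • gradient (P.c i) x

/-- `(x,u)` solves the two-parameter primal-dual system. -/
def SolvesSystem (x : Vec n) (u : Vec m) : Prop :=
  P.lagGrad β ρ x u = 0 ∧ ∀ i, P.c i x + P.y β ρ x u i = 0

/-- `φ_{(β,ρ)}(x,u) ∈ ℝⁿ⁺ᵐ`, as a plain function type, so that `‖φ‖` is the maximum norm. -/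
def phi (x : Vec n) (u : Vec m) : Fin n ⊕ Fin m → ℝ :=
  Sum.elim (fun j => P.lagGrad β ρ x u j) (fun i => ρ * (P.c i x + P.y β ρ x u i))

/-- The product `R v` of the `(n+m) × m` matrix `R` at `(x,u)` with `v ∈ ℝᵐ`; column `i` of `R` is
`(λ_i/(y_i+λ_i) ∇c_i(x), -ρ y_i/(y_i+λ_i) e_i)`. -/
def R (x : Vec n) (u : Vec m) (v : Vec m) : PairVec n m :=
  WithLp.toLp 2
    (∑ i, (P.lam β ρ x u i / (P.y β ρ x u i + P.lam β ρ x u i) * v i) • gradient (P.c i) x,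
     WithLp.toLp 2 fun i => -(ρ * (P.y β ρ x u i / (P.y β ρ x u i + P.lam β ρ x u i))) * v i)

/-- The product `Rᵀ d`, for `d = (d_x,d_u)`. -/
def RT (x : Vec n) (u : Vec m) (d : PairVec n m) : Vec m :=
  WithLp.toLp 2 fun i =>
    P.lam β ρ x u i / (P.y β ρ x u i + P.lam β ρ x u i) * inner ℝ (gradient (P.c i) x) d.fst
      - ρ * (P.y β ρ x u i / (P.y β ρ x u i + P.lam β ρ x u i)) * d.snd i

/-- `RT` is indeed the transpose of `R`. -/
theorem inner_R (x : Vec n) (u v : Vec m) (d : PairVec n m) :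
    inner ℝ (P.R β ρ x u v) d = inner ℝ v (P.RT β ρ x u d) := by
  have h : ∀ a b : Vec m, inner ℝ a b = ∑ i, a i * b i := fun a b => by
    simp [PiLp.inner_apply, mul_comm]
  simp only [R, RT, WithLp.prod_inner_apply, sum_inner, real_inner_smul_left, h,
    ← Finset.sum_add_distrib, WithLp.fst, WithLp.snd]
  refine Finset.sum_congr rfl fun i _ => ?_
  ring

/-- The product `Q d` of the `(n+m) × (n+m)` matrix `Q` at `(x,u)` (built with `H`) with `d`. -/
def Q (H : Vec n →L[ℝ] Vec n) (x : Vec n) (u : Vec m) (d : PairVec n m) : PairVec n m :=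
  WithLp.toLp 2
    (H d.fst
      + ∑ i, (ρ * β / (P.y β ρ x u i + P.lam β ρ x u i) ^ 2
          * inner ℝ (gradient (P.c i) x) d.fst) • gradient (P.c i) x
      + ∑ i, (ρ ^ 2 * β / (P.y β ρ x u i + P.lam β ρ x u i) ^ 2 * d.snd i) • gradient (P.c i) x,
     WithLp.toLp 2 fun i =>
      ρ ^ 2 * β / (P.y β ρ x u i + P.lam β ρ x u i) ^ 2 * inner ℝ (gradient (P.c i) x) d.fst
        + ρ ^ 3 * β / (P.y β ρ x u i + P.lam β ρ x u i) ^ 2 * d.snd i)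

/-- The linear part
`ρ ∇f(x)ᵀ d_x + ∑ᵢ ρβ/(y_i+λ_i) (∇c_i(x)ᵀ d_x + ρ d_{u,i})` of the quadratic objective. -/
def lin (x : Vec n) (u : Vec m) (d : PairVec n m) : ℝ :=
  ρ * inner ℝ (gradient P.f x) d.fst
    + ∑ i, ρ * β / (P.y β ρ x u i + P.lam β ρ x u i)
        * (inner ℝ (gradient (P.c i) x) d.fst + ρ * d.snd i)

/-- The objective `q̂(d)` of the null-space quadratic program. -/
def qhat (H : Vec n →L[ℝ] Vec n) (x : Vec n) (u : Vec m) (d : PairVec n m) : ℝ :=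
  P.lin β ρ x u d + (1 / 2) * inner ℝ d.fst (H d.fst)
    + (1 / 2) * ∑ i, ρ * β / (P.y β ρ x u i + P.lam β ρ x u i) ^ 2
        * (inner ℝ (gradient (P.c i) x) d.fst + ρ * d.snd i) ^ 2

/-- The quadratic part of `q̂` is `½ dᵀ Q d`. -/
theorem qhat_eq (H : Vec n →L[ℝ] Vec n) (x : Vec n) (u : Vec m) (d : PairVec n m) :
    P.qhat β ρ H x u d = P.lin β ρ x u d + (1 / 2) * inner ℝ d (P.Q β ρ H x u d) := by
  have h : ∀ a b : Vec m, inner ℝ a b = ∑ i, a i * b i := fun a b => by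
    simp [PiLp.inner_apply, mul_comm]
  simp only [qhat, Q, WithLp.prod_inner_apply, inner_add_right, inner_sum, real_inner_smul_right,
    h, WithLp.fst, WithLp.snd]
  rw [add_assoc, ← mul_add, add_assoc, add_assoc, ← Finset.sum_add_distrib,
    ← Finset.sum_add_distrib]
  congr 3
  refine Finset.sum_congr rfl fun i _ => ?_
  rw [real_inner_comm]
  ring

/-- `d` solves: minimize `q̂(d)` subject to `Rᵀ d = Rᵀ dᶜ`. -/
def IsQPSolution (H : Vec n →L[ℝ] Vec n) (x : Vec n) (u : Vec m) (dc d : PairVec n m) : Prop :=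
  P.RT β ρ x u d = P.RT β ρ x u dc ∧
    ∀ d' : PairVec n m, P.RT β ρ x u d' = P.RT β ρ x u dc →
      P.qhat β ρ H x u d ≤ P.qhat β ρ H x u d'

/-- `π_ξ(z;d)`. -/
def pred (ξ : ℝ) (x : Vec n) (u : Vec m) (d : PairVec n m) : ℝ :=
  ξ * P.lin β ρ x u d + ‖P.r β ρ x u + P.RT β ρ x u d‖ - ‖P.r β ρ x u‖

/-- The merit function `Φ_ξ(x,u;β,ρ)`. -/
def merit (ξ : ℝ) (x : Vec n) (u : Vec m) : ℝ :=
  ξ * ρ * P.f x - ξ * ρ * β * ∑ i, Real.log (P.y β ρ x u i) + ‖P.r β ρ x u‖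

/-- The condition that the penalty parameter `ξ` has to satisfy at `z = (x,u)` with step `d`. -/
def PenaltyCond (δ : ℝ) (H : Vec n →L[ℝ] Vec n) (x : Vec n) (u : Vec m) (d : PairVec n m)
    (ξ : ℝ) : Prop :=
  P.pred β ρ ξ x u d + (1 - δ) * (‖P.r β ρ x u‖ - ‖P.r β ρ x u + P.RT β ρ x u d‖)
    ≤ -(1 / 2) * ξ * inner ℝ d (P.Q β ρ H x u d)

/-- The sufficient-decrease condition of the line search for the step-size `a`. -/
def DecreaseCond (σ ξ : ℝ) (x : Vec n) (u : Vec m) (d : PairVec n m) (a : ℝ) : Prop :=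
  P.merit β ρ ξ (x + a • d.fst) (u + a • d.snd) - P.merit β ρ ξ x u
    ≤ σ * a * P.pred β ρ ξ x u d

end

end NLP

/-- The sequences produced by the inner loop: iterates `(x_k,u_k)`, (approximate) Hessians `H_k`,
auxiliary steps `d_k^c`, search directions `d_k`, penalty parameters `ξ_k`, step-sizes `α_k`. -/
structure InnerSeq (n m : ℕ) where
  x : ℕ → Vec n
  u : ℕ → Vec m
  H : ℕ → (Vec n →L[ℝ] Vec n)
  dc : ℕ → PairVec n m
  d : ℕ → PairVec n m
  ξ : ℕ → ℝ
  α : ℕ → ℝ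

namespace InnerSeq

noncomputable section

variable {n m : ℕ} (s : InnerSeq n m) (P : NLP n m) (β ρ : ℝ)

/-- The residual `r_k = c(x_k) + y_k`. -/
def r (k : ℕ) : Vec m := P.r β ρ (s.x k) (s.u k)

/-- The vector `R_k r_k`. -/
def Rr (k : ℕ) : PairVec n m := P.R β ρ (s.x k) (s.u k) (s.r P β ρ k)

/-- The sequences are an infinite run of the inner loop for fixed `β` and `ρ`, with the stopping
tests left aside (those are `StopsAt` below). -/
structure IsRun (δ σ : ℝ) : Prop where
  xi_zero : s.ξ 0 = 1
  xi_pos : ∀ k, 0 < s.ξ k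
  /-- `d_k` solves the quadratic program. -/
  direction : ∀ k, P.IsQPSolution β ρ (s.H k) (s.x k) (s.u k) (s.dc k) (s.d k)
  /-- `ξ_{k+1}` satisfies the penalty condition. -/
  penalty : ∀ k, P.PenaltyCond β ρ δ (s.H k) (s.x k) (s.u k) (s.d k) (s.ξ (k + 1))
  /-- The penalty parameter is kept if it is acceptable ... -/
  penalty_keep : ∀ k, P.PenaltyCond β ρ δ (s.H k) (s.x k) (s.u k) (s.d k) (s.ξ k) →
    s.ξ (k + 1) = s.ξ k
  /-- ... and is at least halved otherwise. -/
  penalty_reduce : ∀ k, ¬ P.PenaltyCond β ρ δ (s.H k) (s.x k) (s.u k) (s.d k) (s.ξ k) →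
    s.ξ (k + 1) ≤ (1 / 2) * s.ξ k
  /-- `α_k` is the largest element of `{1, δ, δ², …}` with sufficient decrease. -/
  line_search : ∀ k, ∃ j : ℕ, s.α k = δ ^ j ∧
    P.DecreaseCond β ρ σ (s.ξ (k + 1)) (s.x k) (s.u k) (s.d k) (δ ^ j) ∧
    ∀ i < j, ¬ P.DecreaseCond β ρ σ (s.ξ (k + 1)) (s.x k) (s.u k) (s.d k) (δ ^ i)
  x_succ : ∀ k, s.x (k + 1) = s.x k + s.α k • (s.d k).fst
  /-- `u_{k+1}` is `û_{k+1} = u_k + α_k d_{u,k}`, cut off at `-β / c_i(x_{k+1})` where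
  `c_i(x_{k+1}) < 0`. -/
  u_succ : ∀ k i, s.u (k + 1) i =
    if 0 ≤ P.c i (s.x (k + 1)) then (s.u k + s.α k • (s.d k).snd) i
    else min ((s.u k + s.α k • (s.d k).snd) i) (-(β / P.c i (s.x (k + 1))))

/-- The standing assumptions of the convergence analysis. -/
structure Assumptions : Prop where
  f_smooth : ContDiff ℝ 2 P.f
  c_smooth : ∀ i, ContDiff ℝ 2 (P.c i)
  x_bounded : ∃ Ω : Set (Vec n), IsOpen Ω ∧ Bornology.IsBounded Ω ∧ ∀ k, s.x k ∈ Ω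
  H_bounded : ∃ M : ℝ, ∀ k, ‖s.H k‖ ≤ M
  H_posdef : ∃ γ > (0 : ℝ), ∀ k, ∀ v : Vec n, ρ * γ * ‖v‖ ^ 2 ≤ inner ℝ v (s.H k v)
  dc_norm : ∃ η₁ > (0 : ℝ), ∀ k, ‖s.dc k‖ ≤ η₁ * ‖s.Rr P β ρ k‖
  dc_decrease : ∃ η₂ > (0 : ℝ), ∀ k, s.r P β ρ k ≠ 0 →
    η₂ * ‖s.Rr P β ρ k‖ ^ 2 / ‖s.r P β ρ k‖
      ≤ ‖s.r P β ρ k‖ - ‖s.r P β ρ k + P.RT β ρ (s.x k) (s.u k) (s.dc k)‖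

/-- One of the two stopping tests of the inner loop holds at the end of iteration `k`. -/
def StopsAt (θ₁ : ℝ → ℝ) (k : ℕ) : Prop :=
  ‖P.phi β ρ (s.x (k + 1)) (s.u (k + 1))‖ ≤ ρ * θ₁ β ∨ s.ξ (k + 1) ≤ (1 / 10) * min (√ρ) 1

end

end InnerSeq

/-- The class of continuous functions `θ : (0,∞) → (0,∞)` with `θ(t) → 0` as `t → 0`. -/
structure IsToleranceFun (θ : ℝ → ℝ) : Prop where
  cont : ContinuousOn θ (Set.Ioi 0)
  pos : ∀ t, 0 < t → 0 < θ t
  lim : Tendsto θ (𝓝[>] 0) (𝓝 0)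

/-! The proof splits on whether `ξ_k` stays above some ε > 0. Since `ξ_k` is nonincreasing and each
change at least halves it, it is eventually constant in that case and tends to 0 otherwise.

Two facts hold in both cases. First, the residuals stay bounded although the merit function changes
with `ξ`: logarithms grow more slowly than the residual, so G = barrier + C + ½‖r‖ is nonnegative
for a suitable C, and an inequality between `ξ_k G_k` and ‖r_k‖ survives both the line search and a
reduction of `ξ` (`exists_merit_bound`). Second, condition (P) says precisely that `ξ` times the
optimal value of the quadratic program is at most δ times the decrease of the linearized residual
(`penaltyCond_iff`). The optimal value is O(‖R_k r_k‖) because `d_k^c` is feasible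
(`exists_qhat_le`), while the decrease is at least η₂‖R_k r_k‖²/‖r_k‖. Hence ‖R_k r_k‖ ≥ η‖r_k‖
makes every small `ξ` acceptable (`xi_bounded_below`); contrapositively, `ξ_k` → 0 forces the ratio
‖R_k r_k‖/‖r_k‖ towards 0 along a subsequence.

If `ξ_k` ≥ ε, the barrier is bounded above, so the slacks stay away from zero (`exists_y_bounds`).
Then λ_i = ρβ/y_i and `u_k` are bounded, and `R_k`, `Q_k` are uniformly nondegenerate. Directions
are bounded, Taylor expansion bounds the step-sizes below (`exists_le_alpha`), and the eventually
fixed merit function decreases and is bounded below, so the predicted decrease tends to 0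
(`tendsto_pred`). It dominates ‖d_k‖² and ‖r_k‖, and stationarity bounds the Lagrangian gradient by
‖d_k‖. Thus φ → 0, which gives the first stopping test and, by continuity, the limit points. If
`ξ_k` → 0, the second test holds; r ≥ 0 comes from the cut-off of `u`. -/

/-! ### Coordinate estimates for the Euclidean norm. -/

theorem EuclideanSpace.norm_le_sum_abs {m : ℕ} (v : EuclideanSpace ℝ (Fin m)) :
    ‖v‖ ≤ ∑ i, |v i| := by
  refine abs_le_of_sq_le_sq' ?_ (Finset.sum_nonneg fun i _ => abs_nonneg _) |>.2
  rw [EuclideanSpace.real_norm_sq_eq]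
  calc ∑ i, v i ^ 2 = ∑ i, |v i| ^ 2 := by simp
    _ ≤ (∑ i, |v i|) ^ 2 := Finset.sum_sq_le_sq_sum_of_nonneg fun i _ => abs_nonneg _

theorem EuclideanSpace.abs_apply_le_norm {m : ℕ} (v : EuclideanSpace ℝ (Fin m)) (i : Fin m) :
    |v i| ≤ ‖v‖ := PiLp.norm_apply_le v i

theorem EuclideanSpace.norm_le_of_abs_le {m : ℕ} {v w : EuclideanSpace ℝ (Fin m)}
    (h : ∀ i, |v i| ≤ |w i|) : ‖v‖ ≤ ‖w‖ := by
  refine abs_le_of_sq_le_sq' ?_ (norm_nonneg _) |>.2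
  rw [EuclideanSpace.real_norm_sq_eq, EuclideanSpace.real_norm_sq_eq]
  exact Finset.sum_le_sum fun i _ => sq_le_sq.2 (h i)

/-! ### Scalar identities for y and λ, and the multiplier cut-off. -/

namespace NLP

variable {n m : ℕ} (P : NLP n m) (β ρ : ℝ)

/-- The sum `y_i + λ_i`, which equals `√((c_i(x) + ρ u_i)² + 4ρβ)`. -/
noncomputable def den (x : Vec n) (u : Vec m) (i : Fin m) : ℝ :=
  P.y β ρ x u i + P.lam β ρ x u i

/-- The directional derivative of `c_i(x) + ρ u_i` along `d`. -/
noncomputable def slope (x : Vec n) (d : PairVec n m) (i : Fin m) : ℝ :=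
  inner ℝ (gradient (P.c i) x) d.fst + ρ * d.snd i

/-- The quadratic form `dᵀ Q d`. -/
noncomputable def quad (H : Vec n →L[ℝ] Vec n) (x : Vec n) (u : Vec m) (d : PairVec n m) : ℝ :=
  inner ℝ d.fst (H d.fst)
    + ∑ i, ρ * β / P.den β ρ x u i ^ 2 * P.slope ρ x d i ^ 2

theorem qhat_eq_quad (H : Vec n →L[ℝ] Vec n) (x : Vec n) (u : Vec m) (d : PairVec n m) :
    P.qhat β ρ H x u d = P.lin β ρ x u d + (1 / 2) * P.quad β ρ H x u d := by
  simp only [qhat, quad, den, slope]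
  ring

theorem inner_Q (H : Vec n →L[ℝ] Vec n) (x : Vec n) (u : Vec m) (d : PairVec n m) :
    inner ℝ d (P.Q β ρ H x u d) = P.quad β ρ H x u d := by
  have := P.qhat_eq β ρ H x u d
  rw [qhat_eq_quad] at this
  linarith

theorem lin_eq (x : Vec n) (u : Vec m) (d : PairVec n m) :
    P.lin β ρ x u d = ρ * inner ℝ (gradient P.f x) d.fst
      + ∑ i, ρ * β / P.den β ρ x u i * P.slope ρ x d i := rfl

section Scalar

variable {β ρ} (hβ : 0 < β) (hρ : 0 < ρ) (x : Vec n) (u : Vec m) (i : Fin m)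

theorem den_eq : P.den β ρ x u i = √((P.c i x + ρ * u i) ^ 2 + 4 * ρ * β) := by
  simp only [den, y, lam]; ring

theorem lam_sub_y : P.lam β ρ x u i - P.y β ρ x u i = P.c i x + ρ * u i := by
  simp only [y, lam]; ring

include hβ hρ

theorem radicand_pos (w : ℝ) : 0 < w ^ 2 + 4 * ρ * β := by positivity

theorem den_sq : P.den β ρ x u i ^ 2 = (P.c i x + ρ * u i) ^ 2 + 4 * ρ * β := by
  rw [den_eq, Real.sq_sqrt (radicand_pos hβ hρ _).le]

theorem den_pos : 0 < P.den β ρ x u i := by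
  rw [den_eq]; exact Real.sqrt_pos.2 (radicand_pos hβ hρ _)

theorem abs_lt_den : |P.c i x + ρ * u i| < P.den β ρ x u i := by
  refine abs_lt_of_sq_lt_sq ?_ (P.den_pos hβ hρ x u i).le
  rw [P.den_sq hβ hρ]
  have : 0 < ρ * β := mul_pos hρ hβ
  linarith

theorem y_pos : 0 < P.y β ρ x u i := by
  have h := (abs_lt.1 (P.abs_lt_den hβ hρ x u i)).2
  rw [den_eq] at h
  simp only [y]; linarith

theorem lam_pos : 0 < P.lam β ρ x u i := by
  have h := (abs_lt.1 (P.abs_lt_den hβ hρ x u i)).1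
  rw [den_eq] at h
  simp only [lam]; linarith

theorem y_mul_lam : P.y β ρ x u i * P.lam β ρ x u i = ρ * β := by
  have h := Real.sq_sqrt (radicand_pos hβ hρ (P.c i x + ρ * u i)).le
  simp only [y, lam]; linear_combination h / 4

theorem y_div_den_nonneg : 0 ≤ P.y β ρ x u i / P.den β ρ x u i :=
  div_nonneg (P.y_pos hβ hρ x u i).le (P.den_pos hβ hρ x u i).le

theorem y_div_den_le_one : P.y β ρ x u i / P.den β ρ x u i ≤ 1 := by
  rw [div_le_one (P.den_pos hβ hρ x u i)]
  have := P.lam_pos hβ hρ x u i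
  simp only [den]; linarith

theorem lam_div_den_nonneg : 0 ≤ P.lam β ρ x u i / P.den β ρ x u i :=
  div_nonneg (P.lam_pos hβ hρ x u i).le (P.den_pos hβ hρ x u i).le

theorem lam_div_den_le_one : P.lam β ρ x u i / P.den β ρ x u i ≤ 1 := by
  rw [div_le_one (P.den_pos hβ hρ x u i)]
  have := P.y_pos hβ hρ x u i
  simp only [den]; linarith

theorem div_den_sq_nonneg : 0 ≤ ρ * β / P.den β ρ x u i ^ 2 := by positivity

theorem div_den_sq_le_one : ρ * β / P.den β ρ x u i ^ 2 ≤ 1 := by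
  have := P.den_pos hβ hρ x u i
  rw [div_le_one (by positivity), P.den_sq hβ hρ]
  nlinarith [sq_nonneg (P.c i x + ρ * u i), mul_pos hρ hβ]

theorem div_den_nonneg : 0 ≤ ρ * β / P.den β ρ x u i := by
  have := P.den_pos hβ hρ x u i
  positivity

theorem div_den_le : ρ * β / P.den β ρ x u i ≤ √(ρ * β) := by
  have h0 : 0 < ρ * β := mul_pos hρ hβ
  rw [div_le_iff₀ (P.den_pos hβ hρ x u i)]
  have h1 : √(ρ * β) ≤ P.den β ρ x u i := by
    rw [den_eq]
    exact Real.sqrt_le_sqrt (by nlinarith [sq_nonneg (P.c i x + ρ * u i)])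
  calc ρ * β = √(ρ * β) * √(ρ * β) := (Real.mul_self_sqrt h0.le).symm
    _ ≤ _ := by gcongr

/-- The residual is nonnegative exactly when the constraint holds or the multiplier estimate is
not too large. -/
theorem r_nonneg_of (h : 0 ≤ P.c i x ∨ u i ≤ -(β / P.c i x)) : 0 ≤ P.r β ρ x u i := by
  have hy := P.y_pos hβ hρ x u i
  change 0 ≤ P.c i x + P.y β ρ x u i
  by_cases hc : 0 ≤ P.c i x
  · linarith
  · have hu := h.resolve_left hc
    push Not at hc
    have h1 : -β ≤ u i * P.c i x := by
      have h2 : -(β / P.c i x) * P.c i x ≤ u i * P.c i x := mul_le_mul_of_nonpos_right hu hc.le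
      rwa [neg_mul, div_mul_cancel₀ _ hc.ne] at h2
    have hl := P.lam_pos hβ hρ x u i
    have hyl := P.y_mul_lam hβ hρ x u i
    have hd := P.lam_sub_y (β := β) (ρ := ρ) x u i
    by_contra hneg
    push Not at hneg
    have h3 : ρ * (u i * P.c i x) ≥ ρ * (-β) := mul_le_mul_of_nonneg_left h1 hρ.le
    -- From yλ = ρβ and λ − y = c + ρu follows (y + c)(λ − c) = ρ(β + uc). Since λ − c > 0, the sign
    -- of the residual is that of β + uc.
    nlinarith [mul_pos (neg_pos.2 hneg) (show 0 < P.lam β ρ x u i - P.c i x by linarith)]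

/-- The identity (y + c)(λ − c) = ρ(β + uc) again, now with β + uc ≤ 0. -/
theorem y_le_neg_c_of {x : Vec n} {u : Vec m} {i : Fin m} (hc : P.c i x < 0)
    (hu : -(β / P.c i x) ≤ u i) : P.y β ρ x u i ≤ -P.c i x := by
  have h1 : u i * P.c i x ≤ -β := by
    have h2 : u i * P.c i x ≤ -(β / P.c i x) * P.c i x := mul_le_mul_of_nonpos_right hu hc.le
    rwa [neg_mul, div_mul_cancel₀ _ hc.ne] at h2
  have hl := P.lam_pos hβ hρ x u i
  have hyl := P.y_mul_lam hβ hρ x u i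
  have hd := P.lam_sub_y (β := β) (ρ := ρ) x u i
  by_contra hneg
  push Not at hneg
  have h3 : ρ * (u i * P.c i x) ≤ ρ * (-β) := mul_le_mul_of_nonneg_left h1 hρ.le
  nlinarith [mul_pos (show 0 < P.y β ρ x u i + P.c i x by linarith)
    (show 0 < P.lam β ρ x u i - P.c i x by linarith)]

/-- `y_i` is a nonincreasing function of `u_i`. -/
theorem y_anti {x : Vec n} {u u' : Vec m} {i : Fin m} (h : u' i ≤ u i) :
    P.y β ρ x u i ≤ P.y β ρ x u' i := by
  have h1 := P.lam_pos hβ hρ x u i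
  have h2 := P.lam_pos hβ hρ x u' i
  have h3 := P.y_pos hβ hρ x u i
  have h4 := P.y_pos hβ hρ x u' i
  have e1 := P.y_mul_lam hβ hρ x u i
  have e2 := P.y_mul_lam hβ hρ x u' i
  have d1 := P.lam_sub_y (β := β) (ρ := ρ) x u i
  have d2 := P.lam_sub_y (β := β) (ρ := ρ) x u' i
  have h5 : ρ * u' i ≤ ρ * u i := mul_le_mul_of_nonneg_left h hρ.le
  by_contra hneg
  push Not at hneg
  -- If y dropped while λ − y does not increase, λ would drop as well, contradicting the constant
  -- product yλ = ρβ.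
  nlinarith [mul_pos (sub_pos.2 hneg) h1, mul_pos h4 h1]

/-- Cutting off the multiplier estimate does not increase the merit function. -/
theorem merit_cut_le {ξ : ℝ} (hξ : 0 ≤ ξ) (x : Vec n) {u û : Vec m}
    (h : ∀ i, u i = if 0 ≤ P.c i x then û i else min (û i) (-(β / P.c i x))) :
    P.merit β ρ ξ x u ≤ P.merit β ρ ξ x û := by
  have hle : ∀ i, u i ≤ û i := fun i => by
    rw [h i]; split_ifs
    · exact le_rfl
    · exact min_le_left _ _
  have hy : ∀ i, P.y β ρ x û i ≤ P.y β ρ x u i := fun i => P.y_anti hβ hρ (hle i)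
  have hlog : ∑ i, Real.log (P.y β ρ x û i) ≤ ∑ i, Real.log (P.y β ρ x u i) :=
    Finset.sum_le_sum fun i _ => Real.log_le_log (P.y_pos hβ hρ x û i) (hy i)
  have hr : ‖P.r β ρ x u‖ ≤ ‖P.r β ρ x û‖ := by
    refine EuclideanSpace.norm_le_of_abs_le fun i => ?_
    change |P.c i x + P.y β ρ x u i| ≤ |P.c i x + P.y β ρ x û i|
    by_cases hc : 0 ≤ P.c i x
    · have e : u i = û i := by rw [h i, if_pos hc]
      have : P.y β ρ x u i = P.y β ρ x û i := by simp only [y, e]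
      rw [this]
    · have e : u i = min (û i) (-(β / P.c i x)) := by rw [h i, if_neg hc]
      push Not at hc
      rcases le_total (û i) (-(β / P.c i x)) with hu | hu
      · rw [min_eq_left hu] at e
        have : P.y β ρ x u i = P.y β ρ x û i := by simp only [y, e]
        rw [this]
      -- At the cut-off value both sign criteria apply, so this residual component becomes exactly
      -- zero.
      · rw [min_eq_right hu] at e
        have h1 : P.y β ρ x u i ≤ -P.c i x := P.y_le_neg_c_of hβ hρ hc e.ge
        have h2 : 0 ≤ P.r β ρ x u i := P.r_nonneg_of hβ hρ x u i (Or.inr e.le)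
        change 0 ≤ P.c i x + P.y β ρ x u i at h2
        have h3 : P.c i x + P.y β ρ x u i = 0 := by linarith
        rw [h3, abs_zero]; exact abs_nonneg _
  have h0 : 0 ≤ ξ * ρ * β := by positivity
  have := mul_le_mul_of_nonneg_left hlog h0
  simp only [merit]
  linarith

end Scalar

end NLP

/-! ### The quadratic program: stationarity and uniform bounds on R and Q. -/

namespace NLP

variable {n m : ℕ} (P : NLP n m) {β ρ : ℝ}

theorem RT_apply (x : Vec n) (u : Vec m) (d : PairVec n m) (i : Fin m) :
    P.RT β ρ x u d i = P.lam β ρ x u i / P.den β ρ x u i * inner ℝ (gradient (P.c i) x) d.fst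
      - ρ * (P.y β ρ x u i / P.den β ρ x u i) * d.snd i := rfl

theorem slope_add_smul (x : Vec n) (d h : PairVec n m) (t : ℝ) (i : Fin m) :
    P.slope ρ x (d + t • h) i = P.slope ρ x d i + t * P.slope ρ x h i := by
  simp [slope, inner_add_right]; ring

theorem lin_add_smul (x : Vec n) (u : Vec m) (d h : PairVec n m) (t : ℝ) :
    P.lin β ρ x u (d + t • h) = P.lin β ρ x u d + t * P.lin β ρ x u h := by
  simp only [lin_eq, slope_add_smul, WithLp.add_fst, WithLp.smul_fst, inner_add_right,
    real_inner_smul_right, mul_add, Finset.sum_add_distrib, Finset.mul_sum]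
  have : ∀ i, ρ * β / P.den β ρ x u i * (t * P.slope ρ x h i)
      = t * (ρ * β / P.den β ρ x u i * P.slope ρ x h i) := fun i => by ring
  simp only [this]
  ring

theorem RT_add_smul (x : Vec n) (u : Vec m) (d h : PairVec n m) (t : ℝ) :
    P.RT β ρ x u (d + t • h) = P.RT β ρ x u d + t • P.RT β ρ x u h := by
  ext i
  simp only [RT_apply, WithLp.add_fst, WithLp.smul_fst, WithLp.add_snd, WithLp.smul_snd,
    inner_add_right, real_inner_smul_right, PiLp.add_apply, PiLp.smul_apply, smul_eq_mul]
  ring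

theorem RT_smul (x : Vec n) (u : Vec m) (d : PairVec n m) (t : ℝ) :
    P.RT β ρ x u (t • d) = t • P.RT β ρ x u d := by
  ext i
  simp only [RT_apply, WithLp.smul_fst, WithLp.smul_snd, real_inner_smul_right,
    PiLp.smul_apply, smul_eq_mul]
  ring

/-- The polarization of `quad`. -/
noncomputable def quadPolar (H : Vec n →L[ℝ] Vec n) (β ρ : ℝ) (x : Vec n) (u : Vec m)
    (d h : PairVec n m) : ℝ :=
  (1 / 2) * (inner ℝ d.fst (H h.fst) + inner ℝ h.fst (H d.fst))
    + ∑ i, ρ * β / P.den β ρ x u i ^ 2 * (P.slope ρ x d i * P.slope ρ x h i)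

/-- `H` need not be symmetric, which is why the polarization averages the two inner products. -/
theorem quad_add_smul (H : Vec n →L[ℝ] Vec n) (x : Vec n) (u : Vec m) (d h : PairVec n m)
    (t : ℝ) :
    P.quad β ρ H x u (d + t • h) = P.quad β ρ H x u d + 2 * t * P.quadPolar H β ρ x u d h
      + t ^ 2 * P.quad β ρ H x u h := by
  have : ∀ i, ρ * β / P.den β ρ x u i ^ 2 * P.slope ρ x (d + t • h) i ^ 2
      = ρ * β / P.den β ρ x u i ^ 2 * P.slope ρ x d i ^ 2
        + 2 * t * (ρ * β / P.den β ρ x u i ^ 2 * (P.slope ρ x d i * P.slope ρ x h i))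
        + t ^ 2 * (ρ * β / P.den β ρ x u i ^ 2 * P.slope ρ x h i ^ 2) := fun i => by
    rw [slope_add_smul]; ring
  simp only [quad, quadPolar, this, Finset.sum_add_distrib, ← Finset.mul_sum, WithLp.add_fst,
    WithLp.smul_fst, map_add, map_smul, inner_add_right, inner_add_left, real_inner_smul_right,
    real_inner_smul_left]
  ring

/-- First-order optimality for the null-space quadratic program. -/
theorem IsQPSolution.stationary {H : Vec n →L[ℝ] Vec n} {x : Vec n} {u : Vec m}
    {dc d : PairVec n m} (hd : P.IsQPSolution β ρ H x u dc d) {h : PairVec n m}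
    (hh : P.RT β ρ x u h = 0) :
    P.lin β ρ x u h + P.quadPolar H β ρ x u d h = 0 := by
  set a := P.lin β ρ x u h + P.quadPolar H β ρ x u d h with ha
  have key : ∀ t : ℝ, 0 ≤ t * a + t ^ 2 * ((1 / 2) * P.quad β ρ H x u h) := fun t => by
    have h1 := hd.2 (d + t • h) (by rw [RT_add_smul, hh, smul_zero, add_zero, hd.1])
    rw [qhat_eq_quad, qhat_eq_quad, lin_add_smul, quad_add_smul] at h1
    rw [ha]; linarith
  -- A quadratic in t without constant term that is nonnegative for all t has discriminant a² ≤ 0.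
  have hdisc := discrim_le_zero (a := (1 / 2) * P.quad β ρ H x u h) (b := a) (c := 0)
    fun t => by have := key t; nlinarith
  rw [discrim] at hdisc
  nlinarith [sq_nonneg a]

section Bounds

variable (hβ : 0 < β) (hρ : 0 < ρ) {M : ℝ} {x : Vec n} (u : Vec m)
  (hf : ‖gradient P.f x‖ ≤ M) (hc : ∀ i, ‖gradient (P.c i) x‖ ≤ M)

include hρ hc in
theorem abs_slope_le (d : PairVec n m) (i : Fin m) : |P.slope ρ x d i| ≤ (M + ρ) * ‖d‖ := by
  have h1 : |inner ℝ (gradient (P.c i) x) d.fst| ≤ M * ‖d‖ :=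
    (abs_real_inner_le_norm _ _).trans (mul_le_mul (hc i) (WithLp.norm_fst_le _ d)
      (norm_nonneg _) ((norm_nonneg _).trans (hc i)))
  have h2 : |ρ * d.snd i| ≤ ρ * ‖d‖ := by
    rw [abs_mul, abs_of_pos hρ]
    exact mul_le_mul_of_nonneg_left
      ((EuclideanSpace.abs_apply_le_norm _ i).trans (WithLp.norm_snd_le _ d)) hρ.le
  calc |P.slope ρ x d i| ≤ _ := abs_add_le _ _
    _ ≤ _ := by linarith

include hβ hρ hf hc in
theorem abs_lin_le (d : PairVec n m) :
    |P.lin β ρ x u d| ≤ (ρ * M + m * (√(ρ * β) * (M + ρ))) * ‖d‖ := by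
  have h1 : |inner ℝ (gradient P.f x) d.fst| ≤ M * ‖d‖ :=
    (abs_real_inner_le_norm _ _).trans (mul_le_mul hf (WithLp.norm_fst_le _ d)
      (norm_nonneg _) ((norm_nonneg _).trans hf))
  have h2 : ∀ i, |ρ * β / P.den β ρ x u i * P.slope ρ x d i| ≤ √(ρ * β) * ((M + ρ) * ‖d‖) :=
    fun i => by
    rw [abs_mul, abs_of_nonneg (P.div_den_nonneg hβ hρ x u i)]
    exact mul_le_mul (P.div_den_le hβ hρ x u i) (P.abs_slope_le hρ hc d i) (abs_nonneg _)
      (Real.sqrt_nonneg _)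
  have h3 : |∑ i, ρ * β / P.den β ρ x u i * P.slope ρ x d i|
      ≤ m * (√(ρ * β) * ((M + ρ) * ‖d‖)) :=
    (Finset.abs_sum_le_sum_abs _ _).trans ((Finset.sum_le_sum fun i _ => h2 i).trans (by simp))
  have h4 : |ρ * inner ℝ (gradient P.f x) d.fst| ≤ ρ * (M * ‖d‖) := by
    rw [abs_mul, abs_of_pos hρ]
    exact mul_le_mul_of_nonneg_left h1 hρ.le
  rw [lin_eq]
  calc _ ≤ _ := abs_add_le _ _
    _ ≤ _ := add_le_add h4 h3
    _ = _ := by ring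

include hβ hρ hc in
theorem norm_RT_le (d : PairVec n m) : ‖P.RT β ρ x u d‖ ≤ (m * (M + ρ)) * ‖d‖ := by
  have h : ∀ i, |P.RT β ρ x u d i| ≤ (M + ρ) * ‖d‖ := fun i => by
    have h1 : |inner ℝ (gradient (P.c i) x) d.fst| ≤ M * ‖d‖ :=
      (abs_real_inner_le_norm _ _).trans (mul_le_mul (hc i) (WithLp.norm_fst_le _ d)
        (norm_nonneg _) ((norm_nonneg _).trans (hc i)))
    have h2 : |d.snd i| ≤ ‖d‖ :=
      (EuclideanSpace.abs_apply_le_norm _ i).trans (WithLp.norm_snd_le _ d)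
    rw [RT_apply]
    refine (abs_sub _ _).trans ?_
    rw [abs_mul, abs_mul, abs_mul, abs_of_pos hρ,
      abs_of_nonneg (P.lam_div_den_nonneg hβ hρ x u i),
      abs_of_nonneg (P.y_div_den_nonneg hβ hρ x u i)]
    have h3 := mul_le_mul (P.lam_div_den_le_one hβ hρ x u i) h1 (abs_nonneg _) zero_le_one
    have h4 := mul_le_mul (P.y_div_den_le_one hβ hρ x u i) h2 (abs_nonneg _) zero_le_one
    have h5 := mul_le_mul_of_nonneg_left h4 hρ.le
    linarith
  refine (EuclideanSpace.norm_le_sum_abs _).trans ((Finset.sum_le_sum fun i _ => h i).trans ?_)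
  simp [mul_assoc]

include hβ hρ hc in
-- Transposition: ‖Rv‖² = ⟨v, RᵀRv⟩, so the bound on Rᵀ carries over.
theorem norm_R_le (v : Vec m) : ‖P.R β ρ x u v‖ ≤ (m * (M + ρ)) * ‖v‖ := by
  set w := P.R β ρ x u v with hw
  have h1 : ‖w‖ ^ 2 ≤ ‖v‖ * ((m * (M + ρ)) * ‖w‖) := by
    rw [← real_inner_self_eq_norm_sq]
    conv_lhs => rw [hw]
    rw [inner_R, ← hw]
    exact (real_inner_le_norm _ _).trans
      (mul_le_mul_of_nonneg_left (P.norm_RT_le hβ hρ u hc w) (norm_nonneg _))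
  rcases (norm_nonneg w).eq_or_lt with h0 | h0
  · have : 0 ≤ (m * (M + ρ)) * ‖v‖ := by
      -- Without constraints nothing forces M ≥ 0, but then the factor m vanishes.
      rcases m.eq_zero_or_pos with rfl | hm
      · simp
      · have := (norm_nonneg _).trans (hc ⟨0, hm⟩)
        positivity
    rwa [← h0]
  · nlinarith

include hβ hρ in
/-- The `u`-block of `R` bounds `R v` from below. -/
theorem le_norm_R {κ : ℝ} (hκ : 0 ≤ κ) (h : ∀ i, κ ≤ P.y β ρ x u i / P.den β ρ x u i) (v : Vec m) :
    ρ * κ * ‖v‖ ≤ ‖P.R β ρ x u v‖ := by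
  have h1 : ‖(ρ * κ) • v‖ ≤ ‖(P.R β ρ x u v).snd‖ := by
    refine EuclideanSpace.norm_le_of_abs_le fun i => ?_
    change |ρ * κ * v i| ≤ |-(ρ * (P.y β ρ x u i / P.den β ρ x u i)) * v i|
    rw [abs_mul, abs_mul (-_), abs_neg, abs_of_nonneg (by positivity : 0 ≤ ρ * κ),
      abs_of_nonneg (mul_nonneg hρ.le (P.y_div_den_nonneg hβ hρ x u i))]
    exact mul_le_mul_of_nonneg_right (mul_le_mul_of_nonneg_left (h i) hρ.le) (abs_nonneg _)
  rw [norm_smul, Real.norm_of_nonneg (by positivity)] at h1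
  exact h1.trans (WithLp.norm_snd_le _ _)

include hβ hρ in
theorem R_eq_zero {v : Vec m} (h : P.R β ρ x u v = 0) : v = 0 := by
  ext i
  have h1 : -(ρ * (P.y β ρ x u i / P.den β ρ x u i)) * v i = 0 := by
    have : (P.R β ρ x u v).snd i = 0 := by rw [h]; simp
    exact this
  have h2 := div_pos (P.y_pos hβ hρ x u i) (P.den_pos hβ hρ x u i)
  have h3 : -(ρ * (P.y β ρ x u i / P.den β ρ x u i)) ≠ 0 := by
    have := mul_pos hρ h2
    exact (neg_neg_of_pos this).ne
  simpa using (mul_eq_zero.1 h1).resolve_left h3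

variable {H : Vec n →L[ℝ] Vec n} {N γ : ℝ}

include hβ hρ hc in
theorem quad_le (hH : ‖H‖ ≤ N) (d : PairVec n m) :
    P.quad β ρ H x u d ≤ (N + m * (M + ρ) ^ 2) * ‖d‖ ^ 2 := by
  have h1 : inner ℝ d.fst (H d.fst) ≤ N * ‖d‖ ^ 2 := by
    have h2 : ‖H d.fst‖ ≤ N * ‖d.fst‖ := H.le_of_opNorm_le hH _
    have h3 := WithLp.norm_fst_le _ d
    have hN := (norm_nonneg H).trans hH
    calc inner ℝ d.fst (H d.fst) ≤ ‖d.fst‖ * ‖H d.fst‖ := real_inner_le_norm _ _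
      _ ≤ ‖d‖ * (N * ‖d‖) := by gcongr; exact h2.trans (by gcongr)
      _ = _ := by ring
  have h2 : ∀ i, ρ * β / P.den β ρ x u i ^ 2 * P.slope ρ x d i ^ 2 ≤ (M + ρ) ^ 2 * ‖d‖ ^ 2 :=
    fun i => by
    have h3 : P.slope ρ x d i ^ 2 ≤ ((M + ρ) * ‖d‖) ^ 2 :=
      sq_le_sq.2 ((P.abs_slope_le hρ hc d i).trans (le_abs_self _))
    calc _ ≤ 1 * P.slope ρ x d i ^ 2 :=
          mul_le_mul_of_nonneg_right (P.div_den_sq_le_one hβ hρ x u i) (sq_nonneg _)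
      _ ≤ _ := by rw [one_mul]; linarith
  have h3 : ∑ i, ρ * β / P.den β ρ x u i ^ 2 * P.slope ρ x d i ^ 2
      ≤ m * ((M + ρ) ^ 2 * ‖d‖ ^ 2) :=
    (Finset.sum_le_sum fun i _ => h2 i).trans (by simp)
  rw [quad]; linarith

include hβ hρ in
theorem quad_nonneg (hγ : 0 ≤ γ) (hH : ∀ v : Vec n, ρ * γ * ‖v‖ ^ 2 ≤ inner ℝ v (H v))
    (d : PairVec n m) : 0 ≤ P.quad β ρ H x u d := by
  have h1 : 0 ≤ inner ℝ d.fst (H d.fst) := le_trans (by positivity) (hH d.fst)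
  have h2 : 0 ≤ ∑ i, ρ * β / P.den β ρ x u i ^ 2 * P.slope ρ x d i ^ 2 :=
    Finset.sum_nonneg fun i _ => mul_nonneg (P.div_den_sq_nonneg hβ hρ x u i) (sq_nonneg _)
  exact add_nonneg h1 h2

include hβ hρ hc in
-- `H` controls d_x. The bound S on y + λ keeps the weights ρβ/(y + λ)² away from zero, so Q also
-- controls the slopes, and ρd_u is recovered as slope minus ∇c·d_x.
theorem norm_sq_le_quad (hγ : 0 < γ) (hH : ∀ v : Vec n, ρ * γ * ‖v‖ ^ 2 ≤ inner ℝ v (H v))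
    {S : ℝ} (hS : ∀ i, P.den β ρ x u i ≤ S) (d : PairVec n m) :
    ‖d‖ ^ 2 ≤ ((1 + 2 * m * M ^ 2 / ρ ^ 2) / (ρ * γ) + 2 / ρ ^ 2 * (S ^ 2 / (ρ * β)))
      * P.quad β ρ H x u d := by
  have hρβ : 0 < ρ * β := mul_pos hρ hβ
  have hργ : 0 < ρ * γ := mul_pos hρ hγ
  set A := inner ℝ d.fst (H d.fst) with hA
  set B := ∑ i, ρ * β / P.den β ρ x u i ^ 2 * P.slope ρ x d i ^ 2 with hB
  have hA0 : ‖d.fst‖ ^ 2 ≤ A / (ρ * γ) := by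
    rw [le_div_iff₀ hργ]; have := hH d.fst; linarith
  have hB0 : 0 ≤ B :=
    Finset.sum_nonneg fun i _ => mul_nonneg (P.div_den_sq_nonneg hβ hρ x u i) (sq_nonneg _)
  have hA1 : 0 ≤ A := le_trans (by positivity) (hH d.fst)
  have h1 : ∑ i, P.slope ρ x d i ^ 2 ≤ S ^ 2 / (ρ * β) * B := by
    rw [hB, Finset.mul_sum]
    refine Finset.sum_le_sum fun i _ => ?_
    have hd := P.den_pos hβ hρ x u i
    have h2 : 1 ≤ S ^ 2 / (ρ * β) * (ρ * β / P.den β ρ x u i ^ 2) := by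
      rw [div_mul_div_cancel₀ hρβ.ne', one_le_div (by positivity)]
      exact pow_le_pow_left₀ hd.le (hS i) 2
    rw [← mul_assoc]
    exact le_mul_of_one_le_left (sq_nonneg _) h2
  have h2 : ρ ^ 2 * ‖d.snd‖ ^ 2
      ≤ 2 * ∑ i, P.slope ρ x d i ^ 2 + 2 * (m * (M ^ 2 * ‖d.fst‖ ^ 2)) := by
    have h3 : ∀ i, ρ ^ 2 * d.snd i ^ 2 ≤ 2 * P.slope ρ x d i ^ 2 + 2 * (M ^ 2 * ‖d.fst‖ ^ 2) :=
      fun i => by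
      have h4 : (inner ℝ (gradient (P.c i) x) d.fst) ^ 2 ≤ M ^ 2 * ‖d.fst‖ ^ 2 := by
        rw [← mul_pow]
        refine sq_le_sq.2 (((abs_real_inner_le_norm _ _).trans ?_).trans (le_abs_self _))
        exact mul_le_mul_of_nonneg_right (hc i) (norm_nonneg _)
      have h5 : ρ * d.snd i = P.slope ρ x d i - inner ℝ (gradient (P.c i) x) d.fst := by
        simp [slope]
      rw [← mul_pow, h5]
      nlinarith [sq_nonneg (P.slope ρ x d i + inner ℝ (gradient (P.c i) x) d.fst)]
    rw [EuclideanSpace.real_norm_sq_eq, Finset.mul_sum]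
    refine (Finset.sum_le_sum fun i _ => h3 i).trans ?_
    rw [Finset.sum_add_distrib, ← Finset.mul_sum]
    simp only [Finset.sum_const, Finset.card_univ, Fintype.card_fin, nsmul_eq_mul]
    linarith
  have h3 : ‖d.snd‖ ^ 2 ≤ 2 / ρ ^ 2 * (S ^ 2 / (ρ * β) * B)
      + 2 * m * M ^ 2 / ρ ^ 2 * (A / (ρ * γ)) := by
    have hp : 0 < ρ ^ 2 := by positivity
    have h4 : ρ ^ 2 * ‖d.snd‖ ^ 2
        ≤ 2 * (S ^ 2 / (ρ * β) * B) + 2 * (m * (M ^ 2 * (A / (ρ * γ)))) :=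
      h2.trans (by gcongr)
    calc ‖d.snd‖ ^ 2 = (ρ ^ 2 * ‖d.snd‖ ^ 2) / ρ ^ 2 := by field_simp
      _ ≤ (2 * (S ^ 2 / (ρ * β) * B) + 2 * (m * (M ^ 2 * (A / (ρ * γ))))) / ρ ^ 2 := by gcongr
      _ = _ := by ring
  rw [WithLp.prod_norm_sq_eq_of_L2]
  have h4 : 0 ≤ (1 + 2 * m * M ^ 2 / ρ ^ 2) / (ρ * γ) * B := by positivity
  have h5 : 0 ≤ 2 / ρ ^ 2 * (S ^ 2 / (ρ * β)) * A := by positivity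
  have h6 : P.quad β ρ H x u d = A + B := rfl
  rw [h6]
  have h7 : (1 + 2 * m * M ^ 2 / ρ ^ 2) / (ρ * γ) * A
      = A / (ρ * γ) + 2 * m * M ^ 2 / ρ ^ 2 * (A / (ρ * γ)) := by ring
  linarith

include hβ hρ hc in
/-- The gradient of the Lagrangian is controlled by the solution of the quadratic program. -/
theorem IsQPSolution.norm_lagGrad_le {dc d : PairVec n m} (hH : ‖H‖ ≤ N)
    (hd : P.IsQPSolution β ρ H x u dc d) :
    ‖P.lagGrad β ρ x u‖ ≤ (N + m * ((M + ρ) * M)) * ‖d‖ := by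
  set v := P.lagGrad β ρ x u with hv
  -- A test direction with x-part the Lagrangian gradient v and u-part solving Rᵀh = 0. Along it the
  -- linear term of the objective equals ‖v‖².
  set h : PairVec n m := WithLp.toLp 2 (v, WithLp.toLp 2 fun i =>
    P.lam β ρ x u i / (ρ * P.y β ρ x u i) * inner ℝ (gradient (P.c i) x) v) with hh
  have hfst : h.fst = v := rfl
  have hsnd : ∀ i, h.snd i
      = P.lam β ρ x u i / (ρ * P.y β ρ x u i) * inner ℝ (gradient (P.c i) x) v := fun i => rfl
  have hRT : P.RT β ρ x u h = 0 := by
    ext i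
    have hy := (P.y_pos hβ hρ x u i).ne'
    have hD := (P.den_pos hβ hρ x u i).ne'
    rw [RT_apply, hfst, hsnd, PiLp.zero_apply]
    field_simp
    ring
  have hslope : ∀ i, P.slope ρ x h i
      = P.den β ρ x u i / P.y β ρ x u i * inner ℝ (gradient (P.c i) x) v := fun i => by
    have hy := (P.y_pos hβ hρ x u i).ne'
    rw [slope, hfst, hsnd]
    simp only [den]
    field_simp
  have hlin : P.lin β ρ x u h = ‖v‖ ^ 2 := by
    have h1 : ∀ i, ρ * β / P.den β ρ x u i * P.slope ρ x h i
        = inner ℝ (P.lam β ρ x u i • gradient (P.c i) x) v := fun i => by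
      have hy := (P.y_pos hβ hρ x u i).ne'
      have hD := (P.den_pos hβ hρ x u i).ne'
      rw [hslope, real_inner_smul_left, ← P.y_mul_lam hβ hρ x u i]
      field_simp
    rw [lin_eq]
    simp only [h1, hfst]
    rw [← sum_inner, ← real_inner_smul_left, ← inner_add_left, ← real_inner_self_eq_norm_sq]
    rfl
  have hst := IsQPSolution.stationary P hd hRT
  have hd1 := WithLp.norm_fst_le _ d
  have hN := (norm_nonneg H).trans hH
  have hpol : |P.quadPolar H β ρ x u d h| ≤ (N + m * ((M + ρ) * M)) * ‖d‖ * ‖v‖ := by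
    have e1 : |inner ℝ d.fst (H h.fst)| ≤ N * ‖d‖ * ‖v‖ := by
      calc _ ≤ ‖d.fst‖ * ‖H h.fst‖ := abs_real_inner_le_norm _ _
        _ ≤ ‖d‖ * (N * ‖v‖) := by gcongr; exact H.le_of_opNorm_le hH _
        _ = _ := by ring
    have e2 : |inner ℝ h.fst (H d.fst)| ≤ N * ‖d‖ * ‖v‖ := by
      calc _ ≤ ‖v‖ * ‖H d.fst‖ := abs_real_inner_le_norm _ _
        _ ≤ ‖v‖ * (N * ‖d‖) := by
          gcongr; exact (H.le_of_opNorm_le hH _).trans (by gcongr)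
        _ = _ := by ring
    have e3 : ∀ i, |ρ * β / P.den β ρ x u i ^ 2 * (P.slope ρ x d i * P.slope ρ x h i)|
        ≤ (M + ρ) * ‖d‖ * (M * ‖v‖) := fun i => by
      have hy := (P.y_pos hβ hρ x u i).ne'
      have hD := (P.den_pos hβ hρ x u i).ne'
      -- The factor (y + λ)/y in the slope of h has no uniform bound, but ρβ = yλ cancels it and
      -- leaves λ/(y + λ) ≤ 1.
      have e4 : ρ * β / P.den β ρ x u i ^ 2 * (P.slope ρ x d i * P.slope ρ x h i)
          = P.lam β ρ x u i / P.den β ρ x u i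
            * (P.slope ρ x d i * inner ℝ (gradient (P.c i) x) v) := by
        rw [hslope, ← P.y_mul_lam hβ hρ x u i]
        field_simp
      have hM := (norm_nonneg _).trans (hc i)
      rw [e4, abs_mul, abs_mul, abs_of_nonneg (P.lam_div_den_nonneg hβ hρ x u i)]
      calc _ ≤ 1 * (|P.slope ρ x d i| * |inner ℝ (gradient (P.c i) x) v|) :=
            mul_le_mul_of_nonneg_right (P.lam_div_den_le_one hβ hρ x u i) (by positivity)
        _ ≤ 1 * (((M + ρ) * ‖d‖) * (M * ‖v‖)) := by
          gcongr
          · exact P.abs_slope_le hρ hc d i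
          · exact (abs_real_inner_le_norm _ _).trans (by gcongr; exact hc i)
        _ = _ := one_mul _
    have e5 : |∑ i, ρ * β / P.den β ρ x u i ^ 2 * (P.slope ρ x d i * P.slope ρ x h i)|
        ≤ m * ((M + ρ) * ‖d‖ * (M * ‖v‖)) :=
      (Finset.abs_sum_le_sum_abs _ _).trans ((Finset.sum_le_sum fun i _ => e3 i).trans (by simp))
    rw [quadPolar]
    refine (abs_add_le _ _).trans ?_
    rw [abs_mul, abs_of_pos (by norm_num : (0 : ℝ) < 1 / 2)]
    have e6 := abs_add_le (inner ℝ d.fst (H h.fst)) (inner ℝ h.fst (H d.fst))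
    linarith
  have hfin : ‖v‖ ^ 2 ≤ (N + m * ((M + ρ) * M)) * ‖d‖ * ‖v‖ := by
    have := (abs_le.1 hpol).1
    linarith
  rcases (norm_nonneg v).eq_or_lt with h0 | h0
  · rw [← h0]
    have : 0 ≤ (m : ℝ) * ((M + ρ) * M) := by
      rcases m.eq_zero_or_pos with rfl | hm
      · simp
      · have := (norm_nonneg _).trans (hc ⟨0, hm⟩)
        positivity
    positivity
  · nlinarith

end Bounds

end NLP

/-! ### Taylor expansion of the merit function. -/

/-- A twice continuously differentiable map has a quadratic Taylor remainder on bounded sets. -/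
theorem ContDiff.exists_norm_taylor_le {E F : Type*} [NormedAddCommGroup E] [NormedSpace ℝ E]
    [ProperSpace E] [NormedAddCommGroup F] [NormedSpace ℝ F] {g : E → F} (hg : ContDiff ℝ 2 g)
    (B : ℝ) : ∃ C : ℝ, 0 ≤ C ∧ ∀ z h : E, ‖z‖ ≤ B → ‖h‖ ≤ B →
      ‖g (z + h) - g z - fderiv ℝ g z h‖ ≤ C * ‖h‖ ^ 2 := by
  have hg1 : ContDiff ℝ 1 (fderiv ℝ g) := hg.fderiv_right (by norm_num)
  -- Radius 2B, so that the ball contains both z and z + h.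
  obtain ⟨K, hK⟩ := hg1.contDiffOn.exists_lipschitzOnWith one_ne_zero
    (convex_closedBall (0 : E) (2 * B)) (isCompact_closedBall _ _)
  refine ⟨K, K.2, fun z h hz hh => ?_⟩
  have hsub : segment ℝ z (z + h) ⊆ Metric.closedBall 0 (2 * B) := by
    refine (convex_closedBall _ _).segment_subset ?_ ?_
    · rw [mem_closedBall_zero_iff]; linarith [norm_nonneg z]
    · rw [mem_closedBall_zero_iff]; linarith [norm_add_le z h]
  have hz0 : z ∈ segment ℝ z (z + h) := left_mem_segment ℝ _ _
  have hlip : ∀ w ∈ segment ℝ z (z + h), ‖fderiv ℝ g w - fderiv ℝ g z‖ ≤ K * ‖h‖ := by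
    intro w hw
    have h1 := hK.norm_sub_le (hsub hw) (hsub hz0)
    have h2 : ‖w - z‖ ≤ ‖h‖ := by
      rw [segment_eq_image'] at hw
      obtain ⟨t, ht, rfl⟩ := hw
      simp only [add_sub_cancel_left, norm_smul, Real.norm_of_nonneg ht.1]
      exact mul_le_of_le_one_left (norm_nonneg _) ht.2
    exact h1.trans (mul_le_mul_of_nonneg_left h2 K.2)
  have h3 := (convex_segment z (z + h)).norm_image_sub_le_of_norm_fderiv_le'
    (fun v _ => (hg.differentiable two_ne_zero) v) hlip hz0 (right_mem_segment ℝ _ _)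
  rw [add_sub_cancel_left] at h3
  calc _ ≤ _ := h3
    _ = _ := by ring

namespace NLP

variable {n m : ℕ} (P : NLP n m) {β ρ : ℝ}

/-- The derivative of `c_i(x) + ρ u_i` as a linear form. -/
noncomputable def slopeCLM (ρ : ℝ) (x : Vec n) (i : Fin m) : Vec n × Vec m →L[ℝ] ℝ :=
  (fderiv ℝ (P.c i) x).comp (ContinuousLinearMap.fst ℝ (Vec n) (Vec m))
    + ρ • (EuclideanSpace.proj i : Vec m →L[ℝ] ℝ).comp (ContinuousLinearMap.snd ℝ (Vec n) (Vec m))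

theorem slopeCLM_apply (x : Vec n) (i : Fin m) (d : PairVec n m) :
    P.slopeCLM ρ x i (d.fst, d.snd) = P.slope ρ x d i := by
  simp [slopeCLM, slope, inner_gradient_left]

theorem contDiff_shift (hc : ∀ i, ContDiff ℝ 2 (P.c i)) (i : Fin m) :
    ContDiff ℝ 2 fun z : Vec n × Vec m => P.c i z.1 + ρ * z.2 i := by
  have h1 : ContDiff ℝ 2 fun z : Vec n × Vec m => z.2 i :=
    ((EuclideanSpace.proj i : Vec m →L[ℝ] ℝ).comp
      (ContinuousLinearMap.snd ℝ (Vec n) (Vec m))).contDiff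
  exact ((hc i).comp contDiff_fst).add (contDiff_const.mul h1)

theorem contDiff_y (hβ : 0 < β) (hρ : 0 < ρ) (hc : ∀ i, ContDiff ℝ 2 (P.c i)) (i : Fin m) :
    ContDiff ℝ 2 fun z : Vec n × Vec m => P.y β ρ z.1 z.2 i := by
  have h := P.contDiff_shift (ρ := ρ) hc i
  exact contDiff_const.mul
    ((((h.pow 2).add contDiff_const).sqrt fun z => (radicand_pos hβ hρ _).ne').sub h)

theorem contDiff_lam (hβ : 0 < β) (hρ : 0 < ρ) (hc : ∀ i, ContDiff ℝ 2 (P.c i)) (i : Fin m) :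
    ContDiff ℝ 2 fun z : Vec n × Vec m => P.lam β ρ z.1 z.2 i := by
  have h := P.contDiff_shift (ρ := ρ) hc i
  exact contDiff_const.mul
    ((((h.pow 2).add contDiff_const).sqrt fun z => (radicand_pos hβ hρ _).ne').add h)

/-- With w = c + ρu = λ − y and √(w² + 4ρβ) = y + λ, the scalar derivative ½(w/√(w² + 4ρβ) − 1) is
−y/(y + λ). -/
theorem hasFDerivAt_y (hβ : 0 < β) (hρ : 0 < ρ) (hc : ∀ i, ContDiff ℝ 2 (P.c i)) (i : Fin m)
    (x : Vec n) (u : Vec m) :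
    HasFDerivAt (fun z : Vec n × Vec m => P.y β ρ z.1 z.2 i)
      ((-(P.y β ρ x u i / P.den β ρ x u i)) • P.slopeCLM ρ x i) (x, u) := by
  have h1 : HasFDerivAt (fun z : Vec n × Vec m => P.c i z.1 + ρ * z.2 i)
      (P.slopeCLM ρ x i) (x, u) := by
    have h2 : HasFDerivAt (fun z : Vec n × Vec m => P.c i z.1)
        ((fderiv ℝ (P.c i) x).comp (ContinuousLinearMap.fst ℝ (Vec n) (Vec m))) (x, u) :=
      HasFDerivAt.comp (x, u) (((hc i).differentiable two_ne_zero) x).hasFDerivAt hasFDerivAt_fst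
    exact h2.add (((EuclideanSpace.proj i : Vec m →L[ℝ] ℝ).comp
      (ContinuousLinearMap.snd ℝ (Vec n) (Vec m))).hasFDerivAt.const_mul ρ)
  have h3 : HasDerivAt (fun w : ℝ => (1 / 2) * (√(w ^ 2 + 4 * ρ * β) - w))
      (-(P.y β ρ x u i / P.den β ρ x u i)) (P.c i x + ρ * u i) := by
    have h4 := ((((hasDerivAt_id (P.c i x + ρ * u i)).pow 2).add_const (4 * ρ * β)).sqrt
      (radicand_pos hβ hρ _).ne').sub (hasDerivAt_id (P.c i x + ρ * u i))
    refine (h4.const_mul (1 / 2)).congr_deriv ?_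
    have hD := (P.den_pos hβ hρ x u i).ne'
    simp only [id, Pi.pow_apply]
    rw [← den_eq, ← P.lam_sub_y (β := β)]
    field_simp
    simp only [den]
    ring
  exact HasDerivAt.comp_hasFDerivAt (f := fun z : Vec n × Vec m => P.c i z.1 + ρ * z.2 i)
    (x, u) h3 h1

/-- The smooth part `ρ f - ρβ ∑ ln y_i` of the merit function. -/
noncomputable def barrier (β ρ : ℝ) (x : Vec n) (u : Vec m) : ℝ :=
  ρ * P.f x - ρ * β * ∑ i, Real.log (P.y β ρ x u i)

theorem merit_eq (ξ : ℝ) (x : Vec n) (u : Vec m) :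
    P.merit β ρ ξ x u = ξ * P.barrier β ρ x u + ‖P.r β ρ x u‖ := by
  simp only [merit, barrier]; ring

theorem contDiff_barrier (hβ : 0 < β) (hρ : 0 < ρ) (hf : ContDiff ℝ 2 P.f)
    (hc : ∀ i, ContDiff ℝ 2 (P.c i)) :
    ContDiff ℝ 2 fun z : Vec n × Vec m => P.barrier β ρ z.1 z.2 :=
  (contDiff_const.mul (hf.comp contDiff_fst)).sub (contDiff_const.mul (ContDiff.sum fun i _ =>
    (P.contDiff_y hβ hρ hc i).log fun z => (P.y_pos hβ hρ z.1 z.2 i).ne'))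

/-- The slack cancels: −ρβ(ln y)' contributes ρβ/y · y/(y + λ) = ρβ/(y + λ). So ℓ is the derivative
of the barrier. -/
theorem fderiv_barrier (hβ : 0 < β) (hρ : 0 < ρ) (hf : ContDiff ℝ 2 P.f)
    (hc : ∀ i, ContDiff ℝ 2 (P.c i)) (x : Vec n) (u : Vec m) (d : PairVec n m) :
    fderiv ℝ (fun z : Vec n × Vec m => P.barrier β ρ z.1 z.2) (x, u) (d.fst, d.snd)
      = P.lin β ρ x u d := by
  have h2 : HasFDerivAt (fun z : Vec n × Vec m => P.f z.1)
      ((fderiv ℝ P.f x).comp (ContinuousLinearMap.fst ℝ (Vec n) (Vec m))) (x, u) :=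
    HasFDerivAt.comp (x, u) ((hf.differentiable two_ne_zero) x).hasFDerivAt hasFDerivAt_fst
  have h3 := (h2.const_mul ρ).sub ((HasFDerivAt.fun_sum (u := Finset.univ) fun i _ =>
    (P.hasFDerivAt_y hβ hρ hc i x u).log (P.y_pos hβ hρ x u i).ne').const_mul (ρ * β))
  have h4 : HasFDerivAt (fun z : Vec n × Vec m => P.barrier β ρ z.1 z.2) _ (x, u) := h3
  rw [h4.fderiv, lin_eq, sub_eq_add_neg, ← neg_smul]
  simp only [add_apply, smul_apply, sum_apply, slopeCLM_apply, smul_eq_mul,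
    ContinuousLinearMap.comp_apply, ContinuousLinearMap.coe_fst', inner_gradient_left,
    Finset.mul_sum]
  congr 1
  refine Finset.sum_congr rfl fun i _ => ?_
  have hy := (P.y_pos hβ hρ x u i).ne'
  have hD := (P.den_pos hβ hρ x u i).ne'
  field_simp

theorem contDiff_r (hβ : 0 < β) (hρ : 0 < ρ) (hc : ∀ i, ContDiff ℝ 2 (P.c i)) (i : Fin m) :
    ContDiff ℝ 2 fun z : Vec n × Vec m => P.r β ρ z.1 z.2 i :=
  ((hc i).comp contDiff_fst).add (P.contDiff_y hβ hρ hc i)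

/-- Since 1 − y/(y + λ) = λ/(y + λ), Rᵀ is the Jacobian of the residual. -/
theorem fderiv_r (hβ : 0 < β) (hρ : 0 < ρ) (hc : ∀ i, ContDiff ℝ 2 (P.c i)) (i : Fin m)
    (x : Vec n) (u : Vec m) (d : PairVec n m) :
    fderiv ℝ (fun z : Vec n × Vec m => P.r β ρ z.1 z.2 i) (x, u) (d.fst, d.snd)
      = P.RT β ρ x u d i := by
  have h2 : HasFDerivAt (fun z : Vec n × Vec m => P.c i z.1)
      ((fderiv ℝ (P.c i) x).comp (ContinuousLinearMap.fst ℝ (Vec n) (Vec m))) (x, u) :=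
    HasFDerivAt.comp (x, u) (((hc i).differentiable two_ne_zero) x).hasFDerivAt hasFDerivAt_fst
  have h4 : HasFDerivAt (fun z : Vec n × Vec m => P.r β ρ z.1 z.2 i) _ (x, u) :=
    h2.add (P.hasFDerivAt_y hβ hρ hc i x u)
  rw [h4.fderiv, RT_apply]
  simp only [add_apply, smul_apply, slopeCLM_apply,
    smul_eq_mul, ContinuousLinearMap.comp_apply, ContinuousLinearMap.coe_fst',
    ← inner_gradient_left]
  have hD := (P.den_pos hβ hρ x u i).ne'
  rw [slope]
  field_simp
  simp only [den]
  ring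

/-- The actual change of the merit function along a step exceeds the predicted one by at most a
quadratic term, uniformly on bounded sets. -/
theorem exists_merit_le (hβ : 0 < β) (hρ : 0 < ρ) (hf : ContDiff ℝ 2 P.f)
    (hc : ∀ i, ContDiff ℝ 2 (P.c i)) (B : ℝ) :
    ∃ C : ℝ, 0 ≤ C ∧ ∀ (x : Vec n) (u : Vec m) (d : PairVec n m) (ξ a : ℝ), ‖x‖ ≤ B → ‖u‖ ≤ B →
      ‖d‖ ≤ B → 0 ≤ ξ → ξ ≤ 1 → 0 ≤ a → a ≤ 1 →
      P.merit β ρ ξ (x + a • d.fst) (u + a • d.snd) - P.merit β ρ ξ x u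
        ≤ a * P.pred β ρ ξ x u d + C * (a ^ 2 * ‖d‖ ^ 2) := by
  obtain ⟨C₀, hC₀, h₀⟩ := (P.contDiff_barrier hβ hρ hf hc).exists_norm_taylor_le B
  choose C hC h using fun i => (P.contDiff_r hβ hρ hc i).exists_norm_taylor_le B
  refine ⟨C₀ + ∑ i, C i, add_nonneg hC₀ (Finset.sum_nonneg fun i _ => hC i),
    fun x u d ξ a hx hu hd hξ0 hξ1 ha0 ha1 => ?_⟩
  have hz : ‖(x, u)‖ ≤ B := norm_prod_le_iff.2 ⟨hx, hu⟩
  have hstep : (x, u) + a • (d.fst, d.snd) = (x + a • d.fst, u + a • d.snd) := rfl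
  have hnd : ‖a • (d.fst, d.snd)‖ ≤ a * ‖d‖ := by
    rw [norm_smul, Real.norm_of_nonneg ha0]
    exact mul_le_mul_of_nonneg_left
      (norm_prod_le_iff.2 ⟨WithLp.norm_fst_le _ d, WithLp.norm_snd_le _ d⟩) ha0
  have hndB : ‖a • (d.fst, d.snd)‖ ≤ B :=
    hnd.trans ((mul_le_of_le_one_left (norm_nonneg _) ha1).trans hd)
  have hsq : ‖a • (d.fst, d.snd)‖ ^ 2 ≤ a ^ 2 * ‖d‖ ^ 2 := by
    rw [← mul_pow]; exact pow_le_pow_left₀ (norm_nonneg _) hnd 2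
  have t₀ := (h₀ _ _ hz hndB).trans (mul_le_mul_of_nonneg_left hsq hC₀)
  have t := fun i => (h i _ _ hz hndB).trans (mul_le_mul_of_nonneg_left hsq (hC i))
  simp only [map_smul, hstep, P.fderiv_barrier hβ hρ hf hc, P.fderiv_r hβ hρ hc,
    smul_eq_mul, Real.norm_eq_abs] at t₀ t
  have hr : ‖P.r β ρ (x + a • d.fst) (u + a • d.snd) - P.r β ρ x u - a • P.RT β ρ x u d‖
      ≤ (∑ i, C i) * (a ^ 2 * ‖d‖ ^ 2) := by
    rw [Finset.sum_mul]
    exact (EuclideanSpace.norm_le_sum_abs _).trans (Finset.sum_le_sum fun i _ => t i)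
  -- Convexity of the norm replaces the linearization at step a by a times its full-step change,
  -- which is what the predicted decrease measures.
  have hconv : ‖P.r β ρ x u + a • P.RT β ρ x u d‖
      ≤ (1 - a) * ‖P.r β ρ x u‖ + a * ‖P.r β ρ x u + P.RT β ρ x u d‖ := by
    have e : P.r β ρ x u + a • P.RT β ρ x u d
        = (1 - a) • P.r β ρ x u + a • (P.r β ρ x u + P.RT β ρ x u d) := by module
    rw [e]
    refine (norm_add_le _ _).trans_eq ?_
    rw [norm_smul, norm_smul, Real.norm_of_nonneg ha0, Real.norm_of_nonneg (sub_nonneg.2 ha1)]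
  have hr2 : ‖P.r β ρ (x + a • d.fst) (u + a • d.snd)‖
      ≤ (∑ i, C i) * (a ^ 2 * ‖d‖ ^ 2) + ‖P.r β ρ x u + a • P.RT β ρ x u d‖ := by
    refine le_trans ?_ (add_le_add_left hr _)
    have h := norm_add_le (P.r β ρ (x + a • d.fst) (u + a • d.snd) - P.r β ρ x u
      - a • P.RT β ρ x u d) (P.r β ρ x u + a • P.RT β ρ x u d)
    rwa [sub_sub, sub_add_cancel, ← sub_sub] at h
  have hb := mul_le_mul_of_nonneg_left (abs_le.1 t₀).2 hξ0
  have hb2 : ξ * (C₀ * (a ^ 2 * ‖d‖ ^ 2)) ≤ C₀ * (a ^ 2 * ‖d‖ ^ 2) :=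
    mul_le_of_le_one_left (by positivity) hξ1
  rw [merit_eq, merit_eq, pred]
  linarith

end NLP

/-! ### Lower bound for the barrier and a reformulation of condition (P). -/

theorem ContDiff.continuous_gradient {n : ℕ} {g : Vec n → ℝ} (hg : ContDiff ℝ 2 g) :
    Continuous (gradient g) :=
  (InnerProductSpace.toDual ℝ (Vec n)).symm.continuous.comp (hg.continuous_fderiv two_ne_zero)

namespace NLP

variable {n m : ℕ} (P : NLP n m) {β ρ : ℝ}

theorem y_le_norm_r_add {x : Vec n} {M : ℝ} (hc : ∀ i, |P.c i x| ≤ M) (u : Vec m) (i : Fin m) :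
    P.y β ρ x u i ≤ ‖P.r β ρ x u‖ + M := by
  have h1 : P.r β ρ x u i = P.c i x + P.y β ρ x u i := rfl
  have h2 := (le_abs_self _).trans (EuclideanSpace.abs_apply_le_norm (P.r β ρ x u) i)
  have h3 := neg_abs_le (P.c i x)
  have h4 := hc i
  linarith

/-- The barrier term is bounded below in terms of the residual. -/
theorem exists_barrier_ge (hβ : 0 < β) (hρ : 0 < ρ) (M : ℝ) :
    ∃ C : ℝ, ∀ (x : Vec n) (u : Vec m), |P.f x| ≤ M → (∀ i, |P.c i x| ≤ M) →
      0 ≤ P.barrier β ρ x u + C + (1 / 2) * ‖P.r β ρ x u‖ := by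
  -- In ln y ≤ y/t + |ln t| this t gives ρβ·y/t = y/(2(m + 1)), so that the m terms together cost at
  -- most ½(‖r‖ + M).
  set t : ℝ := 2 * (ρ * β) * (m + 1) with ht
  have hρβ : 0 < ρ * β := mul_pos hρ hβ
  have hm : (0 : ℝ) ≤ m := m.cast_nonneg
  have htp : 0 < t := by positivity
  refine ⟨ρ * M + (1 / 2) * M + m * (ρ * β * |Real.log t|), fun x u hf hc => ?_⟩
  have hM : 0 ≤ M := (abs_nonneg _).trans hf
  have h1 : ∀ i, ρ * β * Real.log (P.y β ρ x u i)
      ≤ (‖P.r β ρ x u‖ + M) / (2 * (m + 1)) + ρ * β * |Real.log t| := fun i => by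
    have hy := P.y_pos hβ hρ x u i
    have e1 : Real.log (P.y β ρ x u i) = Real.log (P.y β ρ x u i / t) + Real.log t := by
      rw [Real.log_div hy.ne' htp.ne']; ring
    have e2 := Real.log_le_sub_one_of_pos (div_pos hy htp)
    have e3 := le_abs_self (Real.log t)
    have e4 : ρ * β * (P.y β ρ x u i / t) = P.y β ρ x u i / (2 * (m + 1)) := by
      rw [ht]; field_simp
    have e5 : P.y β ρ x u i / (2 * (m + 1)) ≤ (‖P.r β ρ x u‖ + M) / (2 * (m + 1)) :=
      div_le_div_of_nonneg_right (P.y_le_norm_r_add hc u i) (by positivity)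
    have e6 : Real.log (P.y β ρ x u i) ≤ P.y β ρ x u i / t + |Real.log t| := by linarith
    have e7 := mul_le_mul_of_nonneg_left e6 hρβ.le
    rw [mul_add, e4] at e7
    linarith
  have h2 : ρ * β * ∑ i, Real.log (P.y β ρ x u i)
      ≤ m * ((‖P.r β ρ x u‖ + M) / (2 * (m + 1)) + ρ * β * |Real.log t|) := by
    rw [Finset.mul_sum]
    exact (Finset.sum_le_sum fun i _ => h1 i).trans_eq
      (by rw [Finset.sum_const, Finset.card_univ, Fintype.card_fin, nsmul_eq_mul])
  have h3 : m * ((‖P.r β ρ x u‖ + M) / (2 * (m + 1))) ≤ (1 / 2) * (‖P.r β ρ x u‖ + M) := by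
    have : (m : ℝ) / (m + 1) ≤ 1 := (div_le_one (by positivity)).2 (by linarith)
    calc _ = (m : ℝ) / (m + 1) * ((1 / 2) * (‖P.r β ρ x u‖ + M)) := by field_simp
      _ ≤ _ := mul_le_of_le_one_left (by positivity) this
  have h4 : -(ρ * M) ≤ ρ * P.f x := by
    have := mul_le_mul_of_nonneg_left (abs_le.1 hf).1 hρ.le
    linarith
  rw [barrier]
  linarith

/-- The penalty condition compares the decrease of the linearized residual with the optimal value
of the quadratic program. -/
theorem penaltyCond_iff {δ : ℝ} {H : Vec n →L[ℝ] Vec n} {x : Vec n} {u : Vec m}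
    {d : PairVec n m} {ξ : ℝ} :
    P.PenaltyCond β ρ δ H x u d ξ ↔
      ξ * P.qhat β ρ H x u d ≤ δ * (‖P.r β ρ x u‖ - ‖P.r β ρ x u + P.RT β ρ x u d‖) := by
  rw [PenaltyCond, inner_Q, qhat_eq_quad, pred]
  constructor <;> intro h <;> linarith

end NLP

/-! ### Merit function and penalty parameter along a run. -/

namespace InnerSeq

variable {n m : ℕ} {s : InnerSeq n m} {P : NLP n m} {β ρ δ σ : ℝ}

/-- The problem data are bounded along the iterates. -/
theorem Assumptions.exists_bound (h : s.Assumptions P β ρ) :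
    ∃ M : ℝ, ∀ k, ‖s.x k‖ ≤ M ∧ |P.f (s.x k)| ≤ M ∧ ‖gradient P.f (s.x k)‖ ≤ M ∧
      (∀ i, |P.c i (s.x k)| ≤ M) ∧ ∀ i, ‖gradient (P.c i) (s.x k)‖ ≤ M := by
  obtain ⟨Ω, -, hΩ, hx⟩ := h.x_bounded
  have key : ∀ g : Vec n → ℝ, Continuous g → ∃ C, ∀ k, g (s.x k) ≤ C := fun g hg => by
    obtain ⟨C, hC⟩ := hΩ.isCompact_closure.exists_bound_of_continuousOn hg.continuousOn
    exact ⟨C, fun k => (le_abs_self _).trans (hC _ (subset_closure (hx k)))⟩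
  obtain ⟨M₁, h₁⟩ := key _ continuous_norm
  obtain ⟨M₂, h₂⟩ := key _ h.f_smooth.continuous.abs
  obtain ⟨M₃, h₃⟩ := key _ h.f_smooth.continuous_gradient.norm
  obtain ⟨M₄, h₄⟩ := key (fun x => ∑ i, |P.c i x|)
    (continuous_finsetSum _ fun i _ => (h.c_smooth i).continuous.abs)
  obtain ⟨M₅, h₅⟩ := key (fun x => ∑ i, ‖gradient (P.c i) x‖)
    (continuous_finsetSum _ fun i _ => (h.c_smooth i).continuous_gradient.norm)
  refine ⟨|M₁| + |M₂| + |M₃| + |M₄| + |M₅|, fun k => ?_⟩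
  have a₁ := (h₁ k).trans (le_abs_self _)
  have a₂ := (h₂ k).trans (le_abs_self _)
  have a₃ := (h₃ k).trans (le_abs_self _)
  have a₄ := (h₄ k).trans (le_abs_self _)
  have a₅ := (h₅ k).trans (le_abs_self _)
  have b₁ := abs_nonneg M₁
  have b₂ := abs_nonneg M₂
  have b₃ := abs_nonneg M₃
  have b₄ := abs_nonneg M₄
  have b₅ := abs_nonneg M₅
  refine ⟨by linarith, by linarith, by linarith, fun i => ?_, fun i => ?_⟩
  · have := Finset.single_le_sum (f := fun i => |P.c i (s.x k)|) (fun i _ => abs_nonneg _)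
      (Finset.mem_univ i)
    linarith
  · have := Finset.single_le_sum (f := fun i => ‖gradient (P.c i) (s.x k)‖)
      (fun i _ => norm_nonneg _) (Finset.mem_univ i)
    linarith

theorem IsRun.xi_antitone (h : s.IsRun P β ρ δ σ) : Antitone s.ξ :=
  antitone_nat_of_succ_le fun k => by
    by_cases hp : P.PenaltyCond β ρ δ (s.H k) (s.x k) (s.u k) (s.d k) (s.ξ k)
    · exact (h.penalty_keep k hp).le
    · have := h.penalty_reduce k hp
      linarith [h.xi_pos k]

theorem IsRun.xi_le_one (h : s.IsRun P β ρ δ σ) (k : ℕ) : s.ξ k ≤ 1 :=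
  (h.xi_antitone (Nat.zero_le k)).trans_eq h.xi_zero

/-- The decrease of the linearized residual is bounded below in terms of `R_k r_k`. -/
theorem Assumptions.residual_decrease (hass : s.Assumptions P β ρ) (h : s.IsRun P β ρ δ σ) :
    ∃ η₂ > (0 : ℝ), ∀ k, η₂ * ‖s.Rr P β ρ k‖ ^ 2 / ‖s.r P β ρ k‖
      ≤ ‖s.r P β ρ k‖ - ‖s.r P β ρ k + P.RT β ρ (s.x k) (s.u k) (s.d k)‖ := by
  obtain ⟨η₁, -, h₁⟩ := hass.dc_norm
  obtain ⟨η₂, hη₂, h₂⟩ := hass.dc_decrease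
  refine ⟨η₂, hη₂, fun k => ?_⟩
  rw [(h.direction k).1]
  -- For r = 0 the decrease assumption is silent, but then Rr = 0 forces `dc = 0`, and both sides
  -- vanish, the left by x/0 = 0.
  by_cases hr : s.r P β ρ k = 0
  · have hR : s.Rr P β ρ k = 0 := by
      rw [Rr, hr, ← norm_eq_zero, ← sq_eq_zero_iff, ← real_inner_self_eq_norm_sq, NLP.inner_R,
        inner_zero_left]
    have hdc : s.dc k = 0 := by
      have := h₁ k
      rw [hR, norm_zero, mul_zero] at this
      exact norm_le_zero_iff.1 this
    have : P.RT β ρ (s.x k) (s.u k) (0 : PairVec n m) = 0 := by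
      simpa using P.RT_smul (β := β) (ρ := ρ) (s.x k) (s.u k) 0 0
    simp [hr, hR, hdc, this]
  · exact h₂ k hr

theorem IsRun.pred_le (h : s.IsRun P β ρ δ σ) (k : ℕ) :
    P.pred β ρ (s.ξ (k + 1)) (s.x k) (s.u k) (s.d k)
      ≤ -((1 - δ) * (‖s.r P β ρ k‖
            - ‖s.r P β ρ k + P.RT β ρ (s.x k) (s.u k) (s.d k)‖)
          + (1 / 2) * s.ξ (k + 1) * P.quad β ρ (s.H k) (s.x k) (s.u k) (s.d k)) := by
  have := h.penalty k
  rw [NLP.PenaltyCond, NLP.inner_Q] at this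
  simp only [r]
  linarith

theorem IsRun.alpha_pos (h : s.IsRun P β ρ δ σ) (hδ : 0 < δ) (k : ℕ) : 0 < s.α k := by
  obtain ⟨j, hj, -⟩ := h.line_search k
  rw [hj]; exact pow_pos hδ j

theorem IsRun.merit_succ_le (h : s.IsRun P β ρ δ σ) (hβ : 0 < β) (hρ : 0 < ρ) (k : ℕ) :
    P.merit β ρ (s.ξ (k + 1)) (s.x (k + 1)) (s.u (k + 1))
      ≤ P.merit β ρ (s.ξ (k + 1)) (s.x k) (s.u k)
        + σ * s.α k * P.pred β ρ (s.ξ (k + 1)) (s.x k) (s.u k) (s.d k) := by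
  obtain ⟨j, hj, hdec, -⟩ := h.line_search k
  have h1 := P.merit_cut_le hβ hρ (h.xi_pos (k + 1)).le (s.x (k + 1)) (h.u_succ k)
  rw [NLP.DecreaseCond, ← hj, ← h.x_succ k] at hdec
  linarith

theorem pred_nonpos (hass : s.Assumptions P β ρ) (h : s.IsRun P β ρ δ σ) (hβ : 0 < β)
    (hρ : 0 < ρ) (hδ : δ < 1) (k : ℕ) :
    P.pred β ρ (s.ξ (k + 1)) (s.x k) (s.u k) (s.d k) ≤ 0 := by
  obtain ⟨γ, hγ, hH⟩ := hass.H_posdef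
  obtain ⟨η₂, hη₂, h₂⟩ := hass.residual_decrease h
  have h1 := P.quad_nonneg hβ hρ (x := s.x k) (s.u k) hγ.le (hH k) (s.d k)
  have h2 : 0 ≤ η₂ * ‖s.Rr P β ρ k‖ ^ 2 / ‖s.r P β ρ k‖ := by positivity
  have h3 := mul_nonneg (sub_nonneg.2 hδ.le) (h2.trans (h₂ k))
  have h4 := mul_nonneg (mul_nonneg (by norm_num : (0 : ℝ) ≤ 1 / 2) (h.xi_pos (k + 1)).le) h1
  linarith [h.pred_le k]

/-- The merit functions with varying penalty parameter keep the residuals bounded, and control the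
barrier term. -/
theorem exists_merit_bound (hass : s.Assumptions P β ρ) (h : s.IsRun P β ρ δ σ) (hβ : 0 < β)
    (hρ : 0 < ρ) (hδ : 0 < δ ∧ δ < 1) (hσ : 0 < σ) :
    ∃ C V : ℝ, ∀ k, ‖s.r P β ρ k‖ ≤ V ∧
      0 ≤ P.barrier β ρ (s.x k) (s.u k) + C + (1 / 2) * ‖s.r P β ρ k‖ ∧
      s.ξ k * (P.barrier β ρ (s.x k) (s.u k) + C + (1 / 2) * ‖s.r P β ρ k‖) ≤ V := by
  obtain ⟨M, hM⟩ := hass.exists_bound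
  obtain ⟨C, hC⟩ := P.exists_barrier_ge hβ hρ M
  set G : ℕ → ℝ := fun k => P.barrier β ρ (s.x k) (s.u k) + C + (1 / 2) * ‖s.r P β ρ k‖ with hG
  have hG0 : ∀ k, 0 ≤ G k := fun k => hC _ _ (hM k).2.1 (hM k).2.2.2.1
  set V := ‖s.r P β ρ 0‖ + 2 * G 0 with hV
  -- V gives equality at k = 0, where ξ = 1. Lowering ξ shrinks the left side and enlarges the right
  -- one, because V − ‖r‖ ≥ 0. For fixed ξ, ξG + (1 − ξ/2)‖r‖ is the merit function plus ξC, which a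
  -- step does not increase.
  have inv : ∀ k, s.ξ k * G k ≤ (1 - s.ξ k / 2) * (V - ‖s.r P β ρ k‖) := by
    intro k
    induction k with
    | zero => rw [h.xi_zero, hV]; linarith
    | succ k ih =>
      have hle : s.ξ (k + 1) ≤ s.ξ k := h.xi_antitone (Nat.le_succ k)
      have hx1 := h.xi_le_one k
      have hx0 := h.xi_pos k
      have hpos : 0 ≤ V - ‖s.r P β ρ k‖ :=
        nonneg_of_mul_nonneg_right ((mul_nonneg hx0.le (hG0 k)).trans ih) (by linarith)
      have e1 : s.ξ (k + 1) * G k ≤ (1 - s.ξ (k + 1) / 2) * (V - ‖s.r P β ρ k‖) :=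
        (mul_le_mul_of_nonneg_right hle (hG0 k)).trans
          (ih.trans (mul_le_mul_of_nonneg_right (by linarith) hpos))
      have e2 := h.merit_succ_le hβ hρ k
      have e3 := mul_nonpos_of_nonneg_of_nonpos (mul_nonneg hσ.le (h.alpha_pos hδ.1 k).le)
        (pred_nonpos hass h hβ hρ hδ.2 k)
      rw [NLP.merit_eq, NLP.merit_eq] at e2
      simp only [hG, r] at e1 ⊢
      linarith
  have hpos : ∀ k, 0 ≤ V - ‖s.r P β ρ k‖ := fun k =>
    nonneg_of_mul_nonneg_right ((mul_nonneg (h.xi_pos k).le (hG0 k)).trans (inv k))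
      (by linarith [h.xi_le_one k])
  refine ⟨C, V, fun k => ⟨sub_nonneg.1 (hpos k), hG0 k, (inv k).trans ?_⟩⟩
  have h1 : 1 - s.ξ k / 2 ≤ 1 := by linarith [h.xi_pos k]
  exact (mul_le_of_le_one_left (hpos k) h1).trans (by linarith [norm_nonneg (s.r P β ρ k)])

theorem exists_norm_r_le (hass : s.Assumptions P β ρ) (h : s.IsRun P β ρ δ σ) (hβ : 0 < β)
    (hρ : 0 < ρ) (hδ : 0 < δ ∧ δ < 1) (hσ : 0 < σ) : ∃ V : ℝ, ∀ k, ‖s.r P β ρ k‖ ≤ V :=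
  let ⟨_, V, hV⟩ := exists_merit_bound hass h hβ hρ hδ hσ
  ⟨V, fun k => (hV k).1⟩

/-- The optimal values of the quadratic programs are `O(‖R_k r_k‖)`. -/
theorem exists_qhat_le (hass : s.Assumptions P β ρ) (h : s.IsRun P β ρ δ σ) (hβ : 0 < β)
    (hρ : 0 < ρ) (hδ : 0 < δ ∧ δ < 1) (hσ : 0 < σ) :
    ∃ C > (0 : ℝ), ∀ k, P.qhat β ρ (s.H k) (s.x k) (s.u k) (s.d k) ≤ C * ‖s.Rr P β ρ k‖ := by
  obtain ⟨M, hM⟩ := hass.exists_bound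
  obtain ⟨N, hN⟩ := hass.H_bounded
  obtain ⟨η₁, hη₁, h₁⟩ := hass.dc_norm
  obtain ⟨V, hV⟩ := exists_norm_r_le hass h hβ hρ hδ hσ
  have hM0 : 0 ≤ M := (norm_nonneg _).trans (hM 0).1
  have hN0 : 0 ≤ N := (norm_nonneg _).trans (hN 0)
  have hV0 : 0 ≤ V := (norm_nonneg _).trans (hV 0)
  set A := ρ * M + m * (√(ρ * β) * (M + ρ)) with hA
  set B := N + m * (M + ρ) ^ 2 with hB
  -- An upper bound for ‖R_k r_k‖, used to turn its square into a linear term.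
  set D := (m * (M + ρ)) * V with hD
  have hA0 : 0 ≤ A := by positivity
  have hB0 : 0 ≤ B := by positivity
  have hD0 : 0 ≤ D := by positivity
  refine ⟨A * η₁ + B * η₁ ^ 2 * D + 1, by positivity, fun k => ?_⟩
  obtain ⟨-, -, hf, -, hc⟩ := hM k
  set w := ‖s.Rr P β ρ k‖ with hw
  have hw0 : 0 ≤ w := norm_nonneg _
  have hwD : w ≤ D := (P.norm_R_le hβ hρ (s.u k) hc _).trans
    (mul_le_mul_of_nonneg_left (hV k) (by positivity))
  have hdc : ‖s.dc k‖ ≤ η₁ * w := h₁ k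
  have e1 : P.lin β ρ (s.x k) (s.u k) (s.dc k) ≤ A * (η₁ * w) :=
    (le_abs_self _).trans ((P.abs_lin_le hβ hρ (s.u k) hf hc _).trans
      (mul_le_mul_of_nonneg_left hdc hA0))
  have e2 : P.quad β ρ (s.H k) (s.x k) (s.u k) (s.dc k) ≤ B * (η₁ * w) ^ 2 :=
    (P.quad_le hβ hρ (s.u k) hc (hN k) _).trans
      (mul_le_mul_of_nonneg_left (pow_le_pow_left₀ (norm_nonneg _) hdc 2) hB0)
  have e3 : B * (η₁ * w) ^ 2 ≤ B * η₁ ^ 2 * D * w := by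
    calc B * (η₁ * w) ^ 2 = B * η₁ ^ 2 * w * w := by ring
      _ ≤ _ := by gcongr
  have e4 : 0 ≤ B * (η₁ * w) ^ 2 := by positivity
  -- `d_k^c` is feasible, so the optimal value is at most its objective value.
  have e5 := (h.direction k).2 (s.dc k) rfl
  rw [P.qhat_eq_quad β ρ (s.H k) _ _ (s.dc k)] at e5
  linarith

/-- If `R_k r_k` is not small compared with `r_k`, then the penalty parameter stays away from
zero. -/
theorem xi_bounded_below (hass : s.Assumptions P β ρ) (h : s.IsRun P β ρ δ σ) (hβ : 0 < β)
    (hρ : 0 < ρ) (hδ : 0 < δ ∧ δ < 1) (hσ : 0 < σ)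
    (hη : ∃ η > (0 : ℝ), ∀ k, η * ‖s.r P β ρ k‖ ≤ ‖s.Rr P β ρ k‖) :
    ∃ ε > (0 : ℝ), ∀ k, ε ≤ s.ξ k := by
  obtain ⟨η, hη, hr⟩ := hη
  obtain ⟨C, hC, hq⟩ := exists_qhat_le hass h hβ hρ hδ hσ
  obtain ⟨η₂, hη₂, h₂⟩ := hass.residual_decrease h
  -- Below this threshold, ξ·C‖Rr‖ ≤ δη₂η‖Rr‖ ≤ δη₂‖Rr‖²/‖r‖, so (P) holds and ξ is frozen from then
  -- on.
  have keep : ∀ k, s.ξ k ≤ δ * (η₂ * η) / C → s.ξ (k + 1) = s.ξ k := fun k hk => by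
    refine h.penalty_keep k (P.penaltyCond_iff.2 ?_)
    set w := ‖s.Rr P β ρ k‖ with hw
    have hw0 : 0 ≤ w := norm_nonneg _
    have e1 : s.ξ k * C ≤ δ * (η₂ * η) := (le_div_iff₀ hC).1 hk
    have e2 : η₂ * η * w ≤ η₂ * w ^ 2 / ‖s.r P β ρ k‖ := by
      rcases (norm_nonneg (s.r P β ρ k)).eq_or_lt with h0 | h0
      · have hR : s.Rr P β ρ k = 0 := by
          rw [Rr, norm_eq_zero.1 h0.symm, ← norm_eq_zero, ← sq_eq_zero_iff,
            ← real_inner_self_eq_norm_sq, NLP.inner_R, inner_zero_left]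
        simp [hw, hR]
      · rw [le_div_iff₀ h0]
        calc η₂ * η * w * ‖s.r P β ρ k‖ = η₂ * w * (η * ‖s.r P β ρ k‖) := by ring
          _ ≤ η₂ * w * w := by gcongr; exact hr k
          _ = _ := by ring
    calc s.ξ k * P.qhat β ρ (s.H k) (s.x k) (s.u k) (s.d k) ≤ s.ξ k * (C * w) :=
          mul_le_mul_of_nonneg_left (hq k) (h.xi_pos k).le
      _ = (s.ξ k * C) * w := by ring
      _ ≤ δ * (η₂ * η) * w := mul_le_mul_of_nonneg_right e1 hw0
      _ = δ * (η₂ * η * w) := by ring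
      _ ≤ _ := mul_le_mul_of_nonneg_left (e2.trans (h₂ k)) hδ.1.le
  by_cases hex : ∃ k₀, s.ξ k₀ ≤ δ * (η₂ * η) / C
  · obtain ⟨k₀, hk₀⟩ := hex
    have hconst : ∀ j, s.ξ (k₀ + j) = s.ξ k₀ := fun j => by
      induction j with
      | zero => rfl
      | succ j ih => rw [← add_assoc, keep _ (ih.trans_le hk₀), ih]
    refine ⟨s.ξ k₀, h.xi_pos k₀, fun k => ?_⟩
    rw [← hconst k]
    exact h.xi_antitone (Nat.le_add_left k k₀)
  · push Not at hex
    have := hδ.1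
    exact ⟨δ * (η₂ * η) / C, by positivity, fun k => (hex k).le⟩

/-- A penalty parameter that stays away from zero is eventually constant. -/
theorem IsRun.xi_eventually_const (h : s.IsRun P β ρ δ σ)
    (hξ : ∃ ε > (0 : ℝ), ∀ k, ε ≤ s.ξ k) : ∃ ξ' > (0 : ℝ), ∀ᶠ k in atTop, s.ξ k = ξ' := by
  obtain ⟨ε, hε, hle⟩ := hξ
  have hbdd : BddBelow (Set.range s.ξ) := ⟨ε, by rintro _ ⟨k, rfl⟩; exact hle k⟩
  have hlim := tendsto_atTop_ciInf h.xi_antitone hbdd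
  set L := ⨅ k, s.ξ k with hL
  have hLpos : 0 < L := hε.trans_le (le_ciInf hle)
  -- Past K one has ξ < 2L, and a further halving would fall below the infimum L.
  obtain ⟨K, hK⟩ := eventually_atTop.1 (hlim.eventually_lt_const (show L < 2 * L by linarith))
  have hkeep : ∀ k ≥ K, s.ξ (k + 1) = s.ξ k := fun k hk => by
    by_cases hp : P.PenaltyCond β ρ δ (s.H k) (s.x k) (s.u k) (s.d k) (s.ξ k)
    · exact h.penalty_keep k hp
    · have h1 := h.penalty_reduce k hp
      have h2 := hK k hk
      have h3 : L ≤ s.ξ (k + 1) := ciInf_le hbdd _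
      linarith
  refine ⟨s.ξ K, h.xi_pos K, eventually_atTop.2 ⟨K, fun k hk => ?_⟩⟩
  induction k, hk using Nat.le_induction with
  | base => rfl
  | succ k hk ih => rw [hkeep k hk, ih]

theorem IsRun.xi_tendsto_zero (h : s.IsRun P β ρ δ σ)
    (hξ : ¬ ∃ ε > (0 : ℝ), ∀ k, ε ≤ s.ξ k) : Tendsto s.ξ atTop (𝓝 0) := by
  push Not at hξ
  rw [Metric.tendsto_atTop]
  intro ε hε
  obtain ⟨K, hK⟩ := hξ ε hε
  refine ⟨K, fun k hk => ?_⟩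
  rw [Real.dist_eq, sub_zero, abs_of_pos (h.xi_pos k)]
  exact (h.xi_antitone hk).trans_lt hK

end InnerSeq

/-! ### Convergence when the penalty parameter stays away from zero. -/

namespace InnerSeq

variable {n m : ℕ} {s : InnerSeq n m} {P : NLP n m} {β ρ δ σ : ℝ}

/-- If the penalty parameter stays away from zero, then so do the slacks `y_i`. -/
theorem exists_y_bounds (hass : s.Assumptions P β ρ) (h : s.IsRun P β ρ δ σ) (hβ : 0 < β)
    (hρ : 0 < ρ) (hδ : 0 < δ ∧ δ < 1) (hσ : 0 < σ) (hξ : ∃ ε > (0 : ℝ), ∀ k, ε ≤ s.ξ k) :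
    ∃ κ > (0 : ℝ), ∃ Y > (0 : ℝ), ∀ k i,
      κ ≤ P.y β ρ (s.x k) (s.u k) i ∧ P.y β ρ (s.x k) (s.u k) i ≤ Y := by
  obtain ⟨ε, hε, hle⟩ := hξ
  obtain ⟨M, hM⟩ := hass.exists_bound
  obtain ⟨C, V, hV⟩ := exists_merit_bound hass h hβ hρ hδ hσ
  have hρβ : 0 < ρ * β := mul_pos hρ hβ
  have hM0 : 0 ≤ M := (norm_nonneg _).trans (hM 0).1
  have hV0 : 0 ≤ V := (norm_nonneg _).trans (hV 0).1
  -- E bounds the sum over j of ln(V + M + 1) − ln y_j. The terms are nonnegative, so E bounds each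
  -- one and keeps every y_i away from zero.
  set E := (V / ε - C + ρ * M) / (ρ * β) + m * Real.log (V + M + 1) with hE
  refine ⟨Real.exp (Real.log (V + M + 1) - E), Real.exp_pos _, V + M + 1, by linarith,
    fun k i => ?_⟩
  obtain ⟨-, hf, -, hc, -⟩ := hM k
  have hY : ∀ j, P.y β ρ (s.x k) (s.u k) j ≤ V + M + 1 := fun j => by
    have h1 := P.y_le_norm_r_add (β := β) (ρ := ρ) hc (s.u k) j
    have h2 : ‖P.r β ρ (s.x k) (s.u k)‖ ≤ V := (hV k).1
    linarith
  have hy := fun j => P.y_pos hβ hρ (s.x k) (s.u k) j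
  refine ⟨?_, hY i⟩
  have hG : P.barrier β ρ (s.x k) (s.u k) + C + (1 / 2) * ‖s.r P β ρ k‖ ≤ V / ε := by
    rw [le_div_iff₀ hε, mul_comm]
    exact (mul_le_mul_of_nonneg_right (hle k) (hV k).2.1).trans (hV k).2.2
  have hfM : -(ρ * M) ≤ ρ * P.f (s.x k) := by
    have := mul_le_mul_of_nonneg_left (abs_le.1 hf).1 hρ.le
    linarith
  have hsum : -∑ j, Real.log (P.y β ρ (s.x k) (s.u k) j)
      ≤ (V / ε - C + ρ * M) / (ρ * β) := by
    rw [le_div_iff₀ hρβ]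
    rw [NLP.barrier] at hG
    linarith [norm_nonneg (s.r P β ρ k)]
  have hlog : ∀ j, 0 ≤ Real.log (V + M + 1) - Real.log (P.y β ρ (s.x k) (s.u k) j) := fun j =>
    sub_nonneg.2 (Real.log_le_log (hy j) (hY j))
  have h1 := Finset.single_le_sum (fun j _ => hlog j) (Finset.mem_univ i)
  rw [Finset.sum_sub_distrib, Finset.sum_const, Finset.card_univ, Fintype.card_fin,
    nsmul_eq_mul] at h1
  rw [← Real.le_log_iff_exp_le (hy i)]
  linarith

/-- If the penalty parameter stays away from zero, then the iterates are bounded and the matrices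
`R_k` and `Q_k` are uniformly nondegenerate. -/
theorem exists_den_bounds (hass : s.Assumptions P β ρ) (h : s.IsRun P β ρ δ σ) (hβ : 0 < β)
    (hρ : 0 < ρ) (hδ : 0 < δ ∧ δ < 1) (hσ : 0 < σ) (hξ : ∃ ε > (0 : ℝ), ∀ k, ε ≤ s.ξ k) :
    ∃ κ > (0 : ℝ), ∃ S > (0 : ℝ), ∀ k i, κ ≤ P.y β ρ (s.x k) (s.u k) i / P.den β ρ (s.x k) (s.u k) i
      ∧ P.den β ρ (s.x k) (s.u k) i ≤ S := by
  obtain ⟨κ, hκ, Y, hY, hb⟩ := exists_y_bounds hass h hβ hρ hδ hσ hξ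
  have hρβ : 0 < ρ * β := mul_pos hρ hβ
  have hS : 0 < Y + ρ * β / κ := by positivity
  refine ⟨κ / (Y + ρ * β / κ), by positivity, Y + ρ * β / κ, hS, fun k i => ?_⟩
  have hy := P.y_pos hβ hρ (s.x k) (s.u k) i
  have hden : P.den β ρ (s.x k) (s.u k) i ≤ Y + ρ * β / κ := by
    refine add_le_add (hb k i).2 ?_
    rw [le_div_iff₀ hκ, ← P.y_mul_lam hβ hρ (s.x k) (s.u k) i, mul_comm]
    exact mul_le_mul_of_nonneg_right (hb k i).1 (P.lam_pos hβ hρ (s.x k) (s.u k) i).le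
  exact ⟨div_le_div₀ hy.le (hb k i).1 (P.den_pos hβ hρ _ _ i) hden, hden⟩

theorem exists_norm_u_le (hass : s.Assumptions P β ρ) (h : s.IsRun P β ρ δ σ) (hβ : 0 < β)
    (hρ : 0 < ρ) (hδ : 0 < δ ∧ δ < 1) (hσ : 0 < σ) (hξ : ∃ ε > (0 : ℝ), ∀ k, ε ≤ s.ξ k) :
    ∃ B : ℝ, ∀ k, ‖s.u k‖ ≤ B := by
  obtain ⟨κ, -, S, -, hb⟩ := exists_den_bounds hass h hβ hρ hδ hσ hξ
  obtain ⟨M, hM⟩ := hass.exists_bound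
  refine ⟨∑ _i : Fin m, (S + M) / ρ, fun k => (EuclideanSpace.norm_le_sum_abs _).trans
    (Finset.sum_le_sum fun i _ => ?_)⟩
  have e : ρ * |s.u k i| = |ρ * s.u k i| := by rw [abs_mul, abs_of_pos hρ]
  rw [le_div_iff₀ hρ, mul_comm, e]
  have h1 := (P.abs_lt_den hβ hρ (s.x k) (s.u k) i).le.trans (hb k i).2
  have h2 := (hM k).2.2.2.1 i
  calc |ρ * s.u k i| = |(P.c i (s.x k) + ρ * s.u k i) - P.c i (s.x k)| := by congr 1; ring
    _ ≤ _ := abs_sub _ _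
    _ ≤ _ := add_le_add h1 h2

theorem exists_le_norm_Rr (hass : s.Assumptions P β ρ) (h : s.IsRun P β ρ δ σ) (hβ : 0 < β)
    (hρ : 0 < ρ) (hδ : 0 < δ ∧ δ < 1) (hσ : 0 < σ) (hξ : ∃ ε > (0 : ℝ), ∀ k, ε ≤ s.ξ k) :
    ∃ η > (0 : ℝ), ∀ k, η * ‖s.r P β ρ k‖ ≤ ‖s.Rr P β ρ k‖ := by
  obtain ⟨κ, hκ, S, -, hb⟩ := exists_den_bounds hass h hβ hρ hδ hσ hξ
  exact ⟨ρ * κ, mul_pos hρ hκ,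
    fun k => P.le_norm_R hβ hρ (s.u k) hκ.le (fun i => (hb k i).1) (s.r P β ρ k)⟩

theorem exists_norm_d_sq_le (hass : s.Assumptions P β ρ) (h : s.IsRun P β ρ δ σ) (hβ : 0 < β)
    (hρ : 0 < ρ) (hδ : 0 < δ ∧ δ < 1) (hσ : 0 < σ) (hξ : ∃ ε > (0 : ℝ), ∀ k, ε ≤ s.ξ k) :
    ∃ μ > (0 : ℝ), ∀ k,
      μ * ‖s.d k‖ ^ 2 ≤ P.quad β ρ (s.H k) (s.x k) (s.u k) (s.d k) := by
  obtain ⟨κ, -, S, hS, hb⟩ := exists_den_bounds hass h hβ hρ hδ hσ hξ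
  obtain ⟨M, hM⟩ := hass.exists_bound
  obtain ⟨γ, hγ, hH⟩ := hass.H_posdef
  set K := (1 + 2 * m * M ^ 2 / ρ ^ 2) / (ρ * γ) + 2 / ρ ^ 2 * (S ^ 2 / (ρ * β)) with hK
  have hKpos : 0 < K := by positivity
  refine ⟨K⁻¹, inv_pos.2 hKpos, fun k => ?_⟩
  rw [inv_mul_le_iff₀ hKpos]
  exact P.norm_sq_le_quad hβ hρ (s.u k) (hM k).2.2.2.2 hγ (hH k) (fun i => (hb k i).2) (s.d k)

/-- The optimal value is bounded above, while the objective grows at least like ½μ‖d‖² minus a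
multiple of ‖d‖. -/
theorem exists_norm_d_le (hass : s.Assumptions P β ρ) (h : s.IsRun P β ρ δ σ) (hβ : 0 < β)
    (hρ : 0 < ρ) (hδ : 0 < δ ∧ δ < 1) (hσ : 0 < σ) (hξ : ∃ ε > (0 : ℝ), ∀ k, ε ≤ s.ξ k) :
    ∃ D : ℝ, ∀ k, ‖s.d k‖ ≤ D := by
  obtain ⟨μ, hμ, hq⟩ := exists_norm_d_sq_le hass h hβ hρ hδ hσ hξ
  obtain ⟨M, hM⟩ := hass.exists_bound
  obtain ⟨V, hV⟩ := exists_norm_r_le hass h hβ hρ hδ hσ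
  obtain ⟨C, hC, hqh⟩ := exists_qhat_le hass h hβ hρ hδ hσ
  have hM0 : 0 ≤ M := (norm_nonneg _).trans (hM 0).1
  have hV0 : 0 ≤ V := (norm_nonneg _).trans (hV 0)
  set A := ρ * M + m * (√(ρ * β) * (M + ρ)) with hA
  set T := C * ((m * (M + ρ)) * V) with hT
  have hA0 : 0 ≤ A := by positivity
  have hT0 : 0 ≤ T := by positivity
  -- The summand 1 gives ‖d‖ > 1 in the contradiction, so that T ≤ T‖d‖.
  refine ⟨(2 * A + 2 * T) / μ + 1, fun k => ?_⟩
  obtain ⟨-, -, hf, -, hc⟩ := hM k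
  have e1 := (abs_le.1 (P.abs_lin_le hβ hρ (s.u k) hf hc (s.d k))).1
  have e2 : P.qhat β ρ (s.H k) (s.x k) (s.u k) (s.d k) ≤ T :=
    (hqh k).trans (mul_le_mul_of_nonneg_left ((P.norm_R_le hβ hρ (s.u k) hc _).trans
      (mul_le_mul_of_nonneg_left (hV k) (by positivity))) hC.le)
  rw [P.qhat_eq_quad] at e2
  have e3 : μ * ‖s.d k‖ ^ 2 ≤ 2 * A * ‖s.d k‖ + 2 * T := by linarith [hq k]
  by_contra hlt
  push Not at hlt
  have h0 : 0 ≤ (2 * A + 2 * T) / μ := by positivity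
  have e4 : (2 * A + 2 * T) < μ * ‖s.d k‖ := by
    have : (2 * A + 2 * T) / μ < ‖s.d k‖ := by linarith
    rw [div_lt_iff₀ hμ] at this; linarith
  have e5 : 1 < ‖s.d k‖ := by linarith
  have e6 : (2 * A + 2 * T) * ‖s.d k‖ < μ * ‖s.d k‖ * ‖s.d k‖ :=
    mul_lt_mul_of_pos_right e4 (by linarith)
  have e7 : T ≤ T * ‖s.d k‖ := le_mul_of_one_le_right hT0 e5.le
  linarith [sq (‖s.d k‖)]

/-- The step-sizes stay away from zero. -/
theorem exists_le_alpha (hass : s.Assumptions P β ρ) (h : s.IsRun P β ρ δ σ) (hβ : 0 < β)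
    (hρ : 0 < ρ) (hδ : 0 < δ ∧ δ < 1) (hσ : 0 < σ ∧ σ < 1)
    (hξ : ∃ ε > (0 : ℝ), ∀ k, ε ≤ s.ξ k) : ∃ a > (0 : ℝ), ∀ k, a ≤ s.α k := by
  obtain ⟨M, hM⟩ := hass.exists_bound
  obtain ⟨B, hB⟩ := exists_norm_u_le hass h hβ hρ hδ hσ.1 hξ
  obtain ⟨D, hD⟩ := exists_norm_d_le hass h hβ hρ hδ hσ.1 hξ
  obtain ⟨μ, hμ, hq⟩ := exists_norm_d_sq_le hass h hβ hρ hδ hσ.1 hξ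
  obtain ⟨ε, hε, hle⟩ := hξ
  obtain ⟨η₂, hη₂, h₂⟩ := hass.residual_decrease h
  obtain ⟨C, hC, hT⟩ := P.exists_merit_le hβ hρ hass.f_smooth hass.c_smooth (max M (max B D))
  -- For a < τ the Taylor remainder Ca²‖d‖² fits into the fraction 1 − σ of the predicted decrease,
  -- which is at least ½εμ‖d‖². The rejected trial step before α_k is therefore at least τ, and α_k
  -- ≥ δτ.
  set τ := (1 - σ) * ((1 / 2) * ε * μ) / (C + 1) with hτ
  have hσ1 : 0 < 1 - σ := by linarith [hσ.2]
  have hδ0 := hδ.1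
  have hτ0 : 0 < τ := by positivity
  refine ⟨min 1 (δ * τ), by positivity, fun k => ?_⟩
  obtain ⟨j, hj, -, hfail⟩ := h.line_search k
  rw [hj]
  rcases j with _ | j
  · simp
  · have hnot := hfail j (Nat.lt_succ_self j)
    refine (min_le_right _ _).trans ?_
    rw [pow_succ, mul_comm]
    refine mul_le_mul_of_nonneg_right ?_ hδ0.le
    by_contra hlt
    push Not at hlt
    refine hnot ?_
    set a := δ ^ j with ha
    have ha0 : 0 < a := pow_pos hδ0 j
    have ha1 : a ≤ 1 := pow_le_one₀ hδ0.le hδ.2.le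
    have e1 := hT (s.x k) (s.u k) (s.d k) (s.ξ (k + 1)) a
      ((hM k).1.trans (le_max_left _ _))
      ((hB k).trans ((le_max_left _ _).trans (le_max_right _ _)))
      ((hD k).trans ((le_max_right _ _).trans (le_max_right _ _)))
      (h.xi_pos _).le (h.xi_le_one _) ha0.le ha1
    rw [NLP.DecreaseCond]
    set p := P.pred β ρ (s.ξ (k + 1)) (s.x k) (s.u k) (s.d k) with hp
    have e2 : p ≤ -((1 / 2) * ε * μ * ‖s.d k‖ ^ 2) := by
      have f1 := h.pred_le k
      have f2 : 0 ≤ (1 - δ) * (‖s.r P β ρ k‖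
          - ‖s.r P β ρ k + P.RT β ρ (s.x k) (s.u k) (s.d k)‖) :=
        mul_nonneg (by linarith [hδ.2]) (le_trans (by positivity) (h₂ k))
      have f3 : ε * (μ * ‖s.d k‖ ^ 2)
          ≤ s.ξ (k + 1) * P.quad β ρ (s.H k) (s.x k) (s.u k) (s.d k) :=
        mul_le_mul (hle _) (hq k) (by positivity) (h.xi_pos _).le
      linarith
    have e3 : (C + 1) * a ≤ (1 - σ) * ((1 / 2) * ε * μ) := by
      have := (lt_div_iff₀ (by positivity)).1 hlt
      linarith
    have e4 : C * (a ^ 2 * ‖s.d k‖ ^ 2) ≤ a * ((1 - σ) * ((1 / 2) * ε * μ * ‖s.d k‖ ^ 2)) := by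
      have f1 : C * a ≤ (1 - σ) * ((1 / 2) * ε * μ) := by linarith
      calc C * (a ^ 2 * ‖s.d k‖ ^ 2) = (a * ‖s.d k‖ ^ 2) * (C * a) := by ring
        _ ≤ (a * ‖s.d k‖ ^ 2) * ((1 - σ) * ((1 / 2) * ε * μ)) := by gcongr
        _ = _ := by ring
    have e5 : a * ((1 - σ) * p) ≤ a * ((1 - σ) * -((1 / 2) * ε * μ * ‖s.d k‖ ^ 2)) := by
      gcongr
    linarith

/-- The predicted decrease tends to zero if the penalty parameter stays away from zero. -/
theorem tendsto_pred (hass : s.Assumptions P β ρ) (h : s.IsRun P β ρ δ σ) (hβ : 0 < β)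
    (hρ : 0 < ρ) (hδ : 0 < δ ∧ δ < 1) (hσ : 0 < σ ∧ σ < 1)
    (hξ : ∃ ε > (0 : ℝ), ∀ k, ε ≤ s.ξ k) :
    Tendsto (fun k => P.pred β ρ (s.ξ (k + 1)) (s.x k) (s.u k) (s.d k)) atTop (𝓝 0) := by
  obtain ⟨a, ha, hα⟩ := exists_le_alpha hass h hβ hρ hδ hσ hξ
  obtain ⟨ξ', hξ', hev⟩ := h.xi_eventually_const hξ
  obtain ⟨K, hK⟩ := eventually_atTop.1 hev
  obtain ⟨C, V, hV⟩ := exists_merit_bound hass h hβ hρ hδ hσ.1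
  have hξ1 : ξ' ≤ 1 := (hK K le_rfl) ▸ h.xi_le_one K
  -- After the shift by K the penalty parameter is constant, so a single merit function is monotone
  -- along the run.
  set φ : ℕ → ℝ := fun k => P.merit β ρ ξ' (s.x (k + K)) (s.u (k + K)) with hφ
  have hstep : ∀ k, φ (k + 1) ≤ φ k
      + σ * s.α (k + K) * P.pred β ρ (s.ξ (k + K + 1)) (s.x (k + K)) (s.u (k + K))
        (s.d (k + K)) := fun k => by
    have := h.merit_succ_le hβ hρ (k + K)
    rw [hK (k + K + 1) (by omega)] at this ⊢
    simp only [hφ, show k + 1 + K = k + K + 1 by omega]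
    exact this
  have hanti : Antitone φ := antitone_nat_of_succ_le fun k => (hstep k).trans
    (add_le_of_nonpos_right (mul_nonpos_of_nonneg_of_nonpos
      (mul_nonneg hσ.1.le (ha.le.trans (hα _))) (pred_nonpos hass h hβ hρ hδ.2 _)))
  have hbdd : BddBelow (Set.range φ) := by
    refine ⟨-(ξ' * C), ?_⟩
    rintro _ ⟨k, rfl⟩
    have h1 := mul_nonneg hξ'.le (hV (k + K)).2.1
    have h2 : ξ' * ‖s.r P β ρ (k + K)‖ ≤ ‖s.r P β ρ (k + K)‖ :=
      mul_le_of_le_one_left (norm_nonneg _) hξ1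
    have h3 := norm_nonneg (s.r P β ρ (k + K))
    simp only [hφ, NLP.merit_eq]
    simp only [r] at h1 h2 h3
    linarith
  have hlim := tendsto_atTop_ciInf hanti hbdd
  -- Since α ≥ a, these quotients bound the nonpositive predicted change from below.
  have hdiff : Tendsto (fun k => (φ (k + 1) - φ k) / (σ * a)) atTop (𝓝 0) := by
    have := ((hlim.comp (tendsto_add_atTop_nat 1)).sub hlim).div_const (σ * a)
    simpa using this
  rw [← tendsto_add_atTop_iff_nat K]
  refine tendsto_of_tendsto_of_tendsto_of_le_of_le hdiff tendsto_const_nhds (fun k => ?_)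
    fun k => pred_nonpos hass h hβ hρ hδ.2 _
  have hσa : 0 < σ * a := mul_pos hσ.1 ha
  simp only
  rw [div_le_iff₀ hσa]
  have h1 := hstep k
  have h2 := mul_le_mul_of_nonpos_right (mul_le_mul_of_nonneg_left (hα (k + K)) hσ.1.le)
    (pred_nonpos hass h hβ hρ hδ.2 (k + K))
  linarith

theorem tendsto_norm_d (hass : s.Assumptions P β ρ) (h : s.IsRun P β ρ δ σ) (hβ : 0 < β)
    (hρ : 0 < ρ) (hδ : 0 < δ ∧ δ < 1) (hσ : 0 < σ ∧ σ < 1)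
    (hξ : ∃ ε > (0 : ℝ), ∀ k, ε ≤ s.ξ k) : Tendsto (fun k => ‖s.d k‖) atTop (𝓝 0) := by
  have hp := tendsto_pred hass h hβ hρ hδ hσ hξ
  obtain ⟨μ, hμ, hq⟩ := exists_norm_d_sq_le hass h hβ hρ hδ hσ.1 hξ
  obtain ⟨ε, hε, hle⟩ := hξ
  obtain ⟨η₂, hη₂, h₂⟩ := hass.residual_decrease h
  have hsq : Tendsto (fun k => ‖s.d k‖ ^ 2) atTop (𝓝 0) := by
    have hp2 := hp.neg.div_const ((1 / 2) * ε * μ)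
    rw [neg_zero, zero_div] at hp2
    refine squeeze_zero (fun k => sq_nonneg _) (fun k => ?_) hp2
    rw [le_div_iff₀ (by positivity)]
    have f1 := h.pred_le k
    have f2 : 0 ≤ (1 - δ) * (‖s.r P β ρ k‖
        - ‖s.r P β ρ k + P.RT β ρ (s.x k) (s.u k) (s.d k)‖) :=
      mul_nonneg (by linarith [hδ.2]) (le_trans (by positivity) (h₂ k))
    have f3 : ε * (μ * ‖s.d k‖ ^ 2)
        ≤ s.ξ (k + 1) * P.quad β ρ (s.H k) (s.x k) (s.u k) (s.d k) :=
      mul_le_mul (hle _) (hq k) (by positivity) (h.xi_pos _).le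
    linarith
  simpa using hsq.sqrt

/-- The predicted decrease is at least (1 − δ)η₂‖Rr‖²/‖r‖, and ‖Rr‖ ≥ η‖r‖ makes this at least (1 −
δ)η₂η²‖r‖. -/
theorem tendsto_norm_r (hass : s.Assumptions P β ρ) (h : s.IsRun P β ρ δ σ) (hβ : 0 < β)
    (hρ : 0 < ρ) (hδ : 0 < δ ∧ δ < 1) (hσ : 0 < σ ∧ σ < 1)
    (hξ : ∃ ε > (0 : ℝ), ∀ k, ε ≤ s.ξ k) : Tendsto (fun k => ‖s.r P β ρ k‖) atTop (𝓝 0) := by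
  have hp := tendsto_pred hass h hβ hρ hδ hσ hξ
  obtain ⟨η, hη, hr⟩ := exists_le_norm_Rr hass h hβ hρ hδ hσ.1 hξ
  obtain ⟨η₂, hη₂, h₂⟩ := hass.residual_decrease h
  obtain ⟨γ, hγ, hH⟩ := hass.H_posdef
  have hδ1 : 0 < 1 - δ := by linarith [hδ.2]
  have hp2 := hp.neg.div_const ((1 - δ) * (η₂ * η ^ 2))
  rw [neg_zero, zero_div] at hp2
  refine squeeze_zero (fun k => norm_nonneg _) (fun k => ?_) hp2
  rw [le_div_iff₀ (by positivity)]
  have e1 : η₂ * η ^ 2 * ‖s.r P β ρ k‖ ≤ η₂ * ‖s.Rr P β ρ k‖ ^ 2 / ‖s.r P β ρ k‖ := by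
    rcases (norm_nonneg (s.r P β ρ k)).eq_or_lt with h0 | h0
    · simp [← h0]
    · rw [le_div_iff₀ h0]
      calc _ = η₂ * (η * ‖s.r P β ρ k‖) ^ 2 := by ring
        _ ≤ _ := by gcongr; exact hr k
  have e2 := mul_le_mul_of_nonneg_left (e1.trans (h₂ k)) hδ1.le
  have e3 := mul_nonneg (mul_nonneg (by norm_num : (0 : ℝ) ≤ 1 / 2) (h.xi_pos (k + 1)).le)
    (P.quad_nonneg hβ hρ (x := s.x k) (s.u k) hγ.le (hH k) (s.d k))
  linarith [h.pred_le k]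

theorem tendsto_lagGrad (hass : s.Assumptions P β ρ) (h : s.IsRun P β ρ δ σ) (hβ : 0 < β)
    (hρ : 0 < ρ) (hδ : 0 < δ ∧ δ < 1) (hσ : 0 < σ ∧ σ < 1)
    (hξ : ∃ ε > (0 : ℝ), ∀ k, ε ≤ s.ξ k) :
    Tendsto (fun k => P.lagGrad β ρ (s.x k) (s.u k)) atTop (𝓝 0) := by
  obtain ⟨M, hM⟩ := hass.exists_bound
  obtain ⟨N, hN⟩ := hass.H_bounded
  refine squeeze_zero_norm (fun k => NLP.IsQPSolution.norm_lagGrad_le P hβ hρ (s.u k)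
    (hM k).2.2.2.2 (hN k) (h.direction k)) ?_
  simpa using (tendsto_norm_d hass h hβ hρ hδ hσ hξ).const_mul (N + m * ((M + ρ) * M))

theorem tendsto_phi (hass : s.Assumptions P β ρ) (h : s.IsRun P β ρ δ σ) (hβ : 0 < β)
    (hρ : 0 < ρ) (hδ : 0 < δ ∧ δ < 1) (hσ : 0 < σ ∧ σ < 1)
    (hξ : ∃ ε > (0 : ℝ), ∀ k, ε ≤ s.ξ k) :
    Tendsto (fun k => P.phi β ρ (s.x k) (s.u k)) atTop (𝓝 0) := by
  have hL := (tendsto_lagGrad hass h hβ hρ hδ hσ hξ).norm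
  have hr := (tendsto_norm_r hass h hβ hρ hδ hσ hξ).const_mul ρ
  rw [norm_zero] at hL
  rw [mul_zero] at hr
  refine tendsto_pi_nhds.2 fun j => ?_
  rcases j with j | i
  · exact squeeze_zero_norm (fun k => EuclideanSpace.abs_apply_le_norm _ j) hL
  · refine squeeze_zero_norm (fun k => ?_) hr
    change |ρ * P.r β ρ (s.x k) (s.u k) i| ≤ _
    rw [abs_mul, abs_of_pos hρ]
    exact mul_le_mul_of_nonneg_left (EuclideanSpace.abs_apply_le_norm _ i) hρ.le

end InnerSeq

/-! ### Limit points, the sign of the residual, and the subsequence of ratios. -/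

namespace NLP

variable {n m : ℕ} (P : NLP n m) {β ρ : ℝ}

theorem continuous_phi (hβ : 0 < β) (hρ : 0 < ρ) (hf : ContDiff ℝ 2 P.f)
    (hc : ∀ i, ContDiff ℝ 2 (P.c i)) :
    Continuous fun z : Vec n × Vec m => P.phi β ρ z.1 z.2 := by
  have hL : Continuous fun z : Vec n × Vec m => P.lagGrad β ρ z.1 z.2 :=
    ((hf.continuous_gradient.comp continuous_fst).const_smul ρ).add
      (continuous_finsetSum _ fun i _ => (P.contDiff_lam hβ hρ hc i).continuous.smul
        ((hc i).continuous_gradient.comp continuous_fst))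
  refine continuous_pi fun j => ?_
  rcases j with j | i
  · exact (EuclideanSpace.proj j : Vec n →L[ℝ] ℝ).continuous.comp hL
  · exact continuous_const.mul (P.contDiff_r hβ hρ hc i).continuous

theorem solvesSystem_of_phi_eq_zero (hρ : 0 < ρ) {x : Vec n} {u : Vec m}
    (h : P.phi β ρ x u = 0) : P.SolvesSystem β ρ x u := by
  refine ⟨?_, fun i => ?_⟩
  · ext j
    exact congrFun h (Sum.inl j)
  · have h1 : ρ * (P.c i x + P.y β ρ x u i) = 0 := congrFun h (Sum.inr i)
    exact (mul_eq_zero.1 h1).resolve_left hρ.ne'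

end NLP

namespace InnerSeq

variable {n m : ℕ} {s : InnerSeq n m} {P : NLP n m} {β ρ δ σ : ℝ}

theorem solvesSystem_of_mapClusterPt (hass : s.Assumptions P β ρ) (h : s.IsRun P β ρ δ σ)
    (hβ : 0 < β) (hρ : 0 < ρ) (hδ : 0 < δ ∧ δ < 1) (hσ : 0 < σ ∧ σ < 1)
    (hξ : ∃ ε > (0 : ℝ), ∀ k, ε ≤ s.ξ k) {x : Vec n} {u : Vec m}
    (hxu : MapClusterPt (x, u) atTop fun k => (s.x k, s.u k)) : P.SolvesSystem β ρ x u := by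
  refine P.solvesSystem_of_phi_eq_zero hρ ?_
  have h1 := hxu.tendsto_comp
    (P.continuous_phi hβ hρ hass.f_smooth hass.c_smooth).continuousAt
  have h2 : Tendsto ((fun z : Vec n × Vec m => P.phi β ρ z.1 z.2) ∘ fun k => (s.x k, s.u k))
      atTop (𝓝 0) := tendsto_phi hass h hβ hρ hδ hσ hξ
  have h3 : ClusterPt (P.phi β ρ x u) (𝓝 0) := ClusterPt.mono h1 h2
  exact eq_of_nhds_neBot h3

theorem IsRun.r_succ_nonneg (h : s.IsRun P β ρ δ σ) (hβ : 0 < β) (hρ : 0 < ρ) (k : ℕ)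
    (i : Fin m) : 0 ≤ s.r P β ρ (k + 1) i := by
  refine P.r_nonneg_of hβ hρ _ _ i ?_
  by_cases hc : 0 ≤ P.c i (s.x (k + 1))
  · exact Or.inl hc
  · right
    rw [h.u_succ k i, if_neg hc]
    exact min_le_right _ _

/-- If `‖R_k r_k‖ / ‖r_k‖` is not bounded away from zero, then it tends to zero along an infinite
set of indices. -/
theorem exists_infinite_tendsto (hβ : 0 < β) (hρ : 0 < ρ)
    (hη : ¬ ∃ η > (0 : ℝ), ∀ k, η * ‖s.r P β ρ k‖ ≤ ‖s.Rr P β ρ k‖) :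
    ∃ K : Set ℕ, K.Infinite ∧ (∀ k ∈ K, s.r P β ρ k ≠ 0) ∧
      Tendsto (fun k => ‖s.Rr P β ρ k‖ / ‖s.r P β ρ k‖) (atTop ⊓ 𝓟 K) (𝓝 0) := by
  push Not at hη
  set q : ℕ → ℝ := fun k => ‖s.Rr P β ρ k‖ / ‖s.r P β ρ k‖ with hq
  have key : ∀ ε > (0 : ℝ), ∀ N : ℕ, ∃ k, N < k ∧ s.r P β ρ k ≠ 0 ∧ q k < ε := by
    intro ε hε N
    have hpos : ∀ k, s.r P β ρ k ≠ 0 → 0 < q k := fun k hk =>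
      div_pos (norm_pos_iff.2 fun h0 => hk (P.R_eq_zero hβ hρ (s.u k) h0)) (norm_pos_iff.2 hk)
    -- Each ratio with r ≠ 0 is positive because R is injective, so the finitely many up to N have a
    -- positive lower bound ε'. An index with ratio below ε' must lie beyond N.
    obtain ⟨ε', hε', hle, hmin⟩ : ∃ ε' > (0 : ℝ), ε' ≤ ε ∧
        ∀ k ≤ N, s.r P β ρ k ≠ 0 → ε' ≤ q k := by
      clear hη
      induction N with
      | zero =>
        by_cases h0 : s.r P β ρ 0 = 0
        · exact ⟨ε, hε, le_rfl, fun k hk hr => absurd (Nat.le_zero.1 hk ▸ h0) hr⟩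
        · refine ⟨min ε (q 0), lt_min hε (hpos 0 h0), min_le_left _ _, fun k hk _ => ?_⟩
          rw [Nat.le_zero.1 hk]
          exact min_le_right _ _
      | succ N ih =>
        obtain ⟨ε', hε', hle, hmin⟩ := ih
        by_cases h0 : s.r P β ρ (N + 1) = 0
        · refine ⟨ε', hε', hle, fun k hk hr => ?_⟩
          rcases Nat.le_succ_iff.1 hk with hk | rfl
          · exact hmin k hk hr
          · exact absurd h0 hr
        · refine ⟨min ε' (q (N + 1)), lt_min hε' (hpos _ h0), (min_le_left _ _).trans hle,
            fun k hk hr => ?_⟩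
          rcases Nat.le_succ_iff.1 hk with hk | rfl
          · exact (min_le_left _ _).trans (hmin k hk hr)
          · exact min_le_right _ _
    obtain ⟨k, hk⟩ := hη ε' hε'
    have hr : s.r P β ρ k ≠ 0 := fun h0 => by
      rw [h0, norm_zero, mul_zero] at hk
      exact absurd hk (norm_nonneg _).not_gt
    have hlt : q k < ε' := (div_lt_iff₀ (norm_pos_iff.2 hr)).2 hk
    refine ⟨k, ?_, hr, hlt.trans_le hle⟩
    by_contra hkN
    exact absurd (hmin k (not_lt.1 hkN) hr) hlt.not_ge
  obtain ⟨φ, hφ, hφ'⟩ := extraction_forall_of_frequently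
    (P := fun N k => s.r P β ρ k ≠ 0 ∧ q k < 1 / ((N : ℝ) + 1)) fun N =>
      frequently_atTop'.2 (key _ (by positivity))
  refine ⟨Set.range φ, Set.infinite_range_of_injective hφ.injective, ?_, ?_⟩
  · rintro _ ⟨j, rfl⟩
    exact (hφ' j).1
  · refine Metric.tendsto_nhds.2 fun ε hε => ?_
    obtain ⟨N, hN⟩ := exists_nat_one_div_lt hε
    rw [eventually_inf_principal]
    filter_upwards [eventually_ge_atTop (φ N)] with k hk hkK
    obtain ⟨j, rfl⟩ := hkK
    have hNj : (N : ℝ) ≤ j := Nat.cast_le.2 (hφ.le_iff_le.1 hk)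
    have h0 : 0 ≤ q (φ j) := by positivity
    rw [dist_zero_right, Real.norm_of_nonneg h0]
    calc q (φ j) < 1 / ((j : ℝ) + 1) := (hφ' j).2
      _ ≤ 1 / ((N : ℝ) + 1) := by gcongr
      _ < ε := hN

end InnerSeq

theorem mainTheorem1 {n m : ℕ} (P : NLP n m) (β ρ δ σ : ℝ) (hβ : 0 < β) (hρ : 0 < ρ)
    (hδ : 0 < δ ∧ δ < 1) (hσ : 0 < σ ∧ σ < 1 / 2)
    (θ₁ : ℝ → ℝ) (hθ₁ : IsToleranceFun θ₁)
    (s : InnerSeq n m) (hrun : s.IsRun P β ρ δ σ) (hass : s.Assumptions P β ρ) :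
    (((∃ η > (0 : ℝ), ∀ k, η * ‖s.r P β ρ k‖ ≤ ‖s.Rr P β ρ k‖) ∧
        (∃ ξ' > (0 : ℝ), ∀ᶠ k in atTop, s.ξ k = ξ') ∧
        (∀ (x : Vec n) (u : Vec m),
          MapClusterPt (x, u) atTop (fun k => (s.x k, s.u k)) → P.SolvesSystem β ρ x u)) ∨
      (Tendsto s.ξ atTop (𝓝 0) ∧
        (∃ K : Set ℕ, K.Infinite ∧ (∀ k ∈ K, s.r P β ρ k ≠ 0) ∧
          Tendsto (fun k => ‖s.Rr P β ρ k‖ / ‖s.r P β ρ k‖) (atTop ⊓ 𝓟 K) (𝓝 0)) ∧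
        (∀ k, 1 ≤ k → ∀ i, 0 ≤ s.r P β ρ k i) ∧
        ((∀ i, 0 ≤ P.c i (s.x 0) ∨ s.u 0 i ≤ -(β / P.c i (s.x 0))) →
          ∀ k i, 0 ≤ s.r P β ρ k i))) ∧
    ∃ k, s.StopsAt P β ρ θ₁ k := by
  have hσ' : 0 < σ ∧ σ < 1 := ⟨hσ.1, by linarith [hσ.2]⟩
  by_cases hξ : ∃ ε > (0 : ℝ), ∀ k, ε ≤ s.ξ k
  · refine ⟨Or.inl ⟨InnerSeq.exists_le_norm_Rr hass hrun hβ hρ hδ hσ.1 hξ,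
      hrun.xi_eventually_const hξ, fun x u hxu =>
        InnerSeq.solvesSystem_of_mapClusterPt hass hrun hβ hρ hδ hσ' hξ hxu⟩, ?_⟩
    -- Shifted by one, as the tests at iteration k are evaluated at k + 1.
    have h1 := ((InnerSeq.tendsto_phi hass hrun hβ hρ hδ hσ' hξ).comp
      (tendsto_add_atTop_nat 1)).norm
    rw [norm_zero] at h1
    obtain ⟨k, hk⟩ := (h1.eventually_le_const (mul_pos hρ (hθ₁.pos β hβ))).exists
    exact ⟨k, Or.inl hk⟩
  · have hlim := hrun.xi_tendsto_zero hξ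
    have hr : ∀ k, 1 ≤ k → ∀ i, 0 ≤ s.r P β ρ k i := fun k hk i => by
      obtain ⟨k, rfl⟩ := Nat.exists_eq_add_of_le' hk
      exact hrun.r_succ_nonneg hβ hρ k i
    refine ⟨Or.inr ⟨hlim, InnerSeq.exists_infinite_tendsto hβ hρ fun hη =>
      hξ (InnerSeq.xi_bounded_below hass hrun hβ hρ hδ hσ.1 hη), hr, fun h0 k i => ?_⟩, ?_⟩
    · rcases k.eq_zero_or_pos with rfl | hk
      · exact P.r_nonneg_of hβ hρ _ _ i (h0 i)
      · exact hr k hk i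
    · have hpos : 0 < (1 / 10) * min (√ρ) 1 := by
        have := Real.sqrt_pos.2 hρ
        positivity
      obtain ⟨k, hk⟩ :=
        ((hlim.comp (tendsto_add_atTop_nat 1)).eventually_le_const hpos).exists
      exact ⟨k, Or.inr hk⟩
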